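/- Let $\mathbb I=[0,1]$, let $\lambda$ be Lebesgue measure, and let $\operatorname{supp}(\nu)$ denote the complement of the union of all open $\nu$-null sets. For a copula $C$ let $\mu_C$ be its doubly stochastic measure on $\mathbb I^2$, i.e. $\mu_C([0,x]\times[0,y])=C(x,y)$, and let $K_C$ be its Markov kernel, i.e. a regular conditional distribution of $Y$ given $X$ for $(X,Y)\sim C$. For each $x\in\mathbb I$ decompose $K_C(x,\cdot)=K_C^{abs}(x,\cdot)+K_C^{dis}(x,\cdot)+K_C^{sing}(x,\cdot)$, where $K_C^{abs}(x,\cdot)$ is absolutely continuous with respect to $\lambda$, $K_C^{dis}(x,\cdot)$ is discrete (carried by a countable set), and $K_C^{sing}(x,\cdot)$ is singular (carried by a $\lambda$-null set and without point masses). The absolutely continuous, discrete and singular components of $\mu_C$ are the measures on $\mathbb I^2$ determined by $$\mu_C^{\bullet}(E\times F)=\int_E K_C^{\bullet}(x,F)\,d\lambda(x),\qquad \bullet\in\{abs,dis,sing\},\quad E,F\subseteq\mathbb I\text{ Borel}.$$ Let $\gamma$ be a Williamson measure, i.e. a Borel probability measure on $[0,\infty)$ with $\gamma(\{0\})=0$,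 let $\psi(z)=\int_{[0,\infty)}(1-tz)_+\,d\gamma(t)$ for $z\in[0,\infty)$, $\psi(\infty)=0$, be its generator, and let $\varphi(y)=\inf\{z\in[0,\infty]:\psi(z)=y\}$, $y\in\mathbb I$, be the pseudo-inverse of $\psi$. Let $\vartheta$ be a Pickands dependence measure, i.e. a Borel probability measure on $\mathbb I$ with $\int_{\mathbb I}x\,d\vartheta(x)=\frac12$, and let $A(t)=1-t+2\int_0^t\vartheta([0,z])\,dz$, $t\in\mathbb I$, be its Pickands dependence function. Put $$L=\sup\{x\in\mathbb I:\vartheta([0,x])=0\}\ (\text{with }\sup\emptyset=0),\qquad R=\inf\{x\in\mathbb I:\vartheta([0,x])=1\}.$$ Theorem. Assume $\operatorname{supp}(\gamma)=\left[\frac1{\varphi(0)},\infty\right)$ (with $\frac1\infty=0$) and $L<R$. Then there is exactly one copula $C$, the Archimax copula of $(\gamma,\vartheta)$, with $$C(x,y)=\psi\!\left((\varphi(x)+\varphi(y))\,A\!\left(\frac{\varphi(x)}{\varphi(x)+\varphi(y)}\right)\right)\qquad\text{for all }(x,y)\in(0,1)^2,$$ and the following assertions hold for it: (i) if $\gamma$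 is absolutely continuous with respect to $\lambda$, then $\operatorname{supp}(\mu_C^{abs})=\operatorname{supp}(\mu_C)$; (ii) if $\gamma$ is discrete (carried by a countable set), then $\operatorname{supp}(\mu_C^{dis})=\operatorname{supp}(\mu_C)$; (iii) if $\gamma$ is singular (carried by a $\lambda$-null set and without point masses), then $\operatorname{supp}(\mu_C^{sing})=\operatorname{supp}(\mu_C)$. -/

import Mathlib

open MeasureTheory ProbabilityTheory Set
open scoped unitInterval NNReal ENNReal

namespace Archimax

noncomputable section

/-! ### Copulas and their Markov kernels -/

/-- A bivariate copula, given by its doubly stochastic measure `μ_C` on `[0,1]²`: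
a Borel measure both of whose marginals are the uniform distribution on `[0,1]`. -/
@[ext]
structure Copula where
  measure : Measure (I × I)
  map_fst : measure.map Prod.fst = volume
  map_snd : measure.map Prod.snd = volume

namespace Copula

instance (C : Copula) : IsProbabilityMeasure C.measure := by
  constructor
  have h : C.measure.map Prod.fst univ = 1 := by rw [C.map_fst, measure_univ]
  rwa [Measure.map_apply measurable_fst MeasurableSet.univ, preimage_univ] at h

/-- The copula as a function: `C(x,y) = μ_C([0,x] × [0,y])`. -/
def cdf (C : Copula) (x y : I) : ℝ := C.measure.real (Icc 0 x ×ˢ Icc 0 y)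

/-- The Markov kernel `K_C` of `C`: (a version of) the regular conditional distribution of
`Y` given `X`, for `(X,Y) ∼ C`. -/
def markovKernel (C : Copula) : Kernel I I := C.measure.condKernel

instance (C : Copula) : IsMarkovKernel C.markovKernel := by
  unfold markovKernel; infer_instance

end Copula

/-! ### Absolutely continuous, discrete and singular parts of a kernel -/

/-- The set of all `(x,y)` such that `y` is a point mass of `K(x,·)`. -/
def atomSet (K : Kernel I I) : Set (I × I) := {p | K p.1 {p.2} ≠ 0}

lemma measurableSet_atomSet (K : Kernel I I) [IsFiniteKernel K] :
    MeasurableSet (atomSet K) := by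
  have hD : MeasurableSet {q : (I × I) × I | q.2 = q.1.2} :=
    measurableSet_eq_fun measurable_snd (measurable_snd.comp measurable_fst)
  have h := Kernel.measurable_kernel_prodMk_left (κ := K.comap Prod.fst measurable_fst) hD
  have h2 : Measurable fun p : I × I => K p.1 {p.2} := by
    convert h using 2 with p
    rw [Kernel.comap_apply]
    rfl
  exact h2 (measurableSet_singleton (0 : ℝ≥0∞)).compl

/-- The kernel `x ↦ K(x, · ∩ S_x)`, where `S_x = {y | (x,y) ∈ S}` is the `x`-section of `S`. -/
def restrictSections (K : Kernel I I) [IsFiniteKernel K] (S : Set (I × I))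
    (hS : MeasurableSet S) : Kernel I I where
  toFun x := (K x).restrict (Prod.mk x ⁻¹' S)
  measurable' := by
    refine Measure.measurable_of_measurable_coe _ fun B hB => ?_
    have h := Kernel.measurable_kernel_prodMk_left (κ := K) ((measurable_snd hB).inter hS)
    convert h using 2 with x
    rw [Measure.restrict_apply hB]
    rfl

instance (K : Kernel I I) [IsFiniteKernel K] (S : Set (I × I)) (hS : MeasurableSet S) :
    IsFiniteKernel (restrictSections K S hS) :=
  ⟨⟨K.bound, K.bound_lt_top, fun x =>
    (Measure.restrict_apply_le _ _).trans (Kernel.measure_le_bound K x univ)⟩⟩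

/-- `K^abs(x,·)`: the part of `K(x,·)` that is absolutely continuous w.r.t. Lebesgue measure,
with the Radon-Nikodym derivative of `K(x,·)` as its density. -/
def absKernel (K : Kernel I I) : Kernel I I :=
  Kernel.withDensity (Kernel.const I volume) (Kernel.rnDeriv K (Kernel.const I volume))

instance (K : Kernel I I) [IsFiniteKernel K] : IsFiniteKernel (absKernel K) := by
  unfold absKernel; infer_instance

/-- `K^dis(x,·)`: the restriction of `K(x,·)` to its point masses. -/
def disKernel (K : Kernel I I) [IsFiniteKernel K] : Kernel I I :=
  restrictSections K (atomSet K) (measurableSet_atomSet K)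

instance (K : Kernel I I) [IsFiniteKernel K] : IsFiniteKernel (disKernel K) := by
  unfold disKernel; infer_instance

/-- `K^sing(x,·)`: the part of `K(x,·)` that is carried by a Lebesgue null set and has no point
masses, i.e. the singular part of the Lebesgue decomposition of `K(x,·)`, deprived of the point
masses of `K(x,·)`. -/
def singKernel (K : Kernel I I) [IsFiniteKernel K] : Kernel I I :=
  restrictSections (Kernel.singularPart K (Kernel.const I volume)) (atomSet K)ᶜ
    (measurableSet_atomSet K).compl

instance (K : Kernel I I) [IsFiniteKernel K] : IsFiniteKernel (singKernel K) := by
  unfold singKernel; infer_instance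

namespace Copula

/-- `μ_C^abs`, with `μ_C^abs(E × F) = ∫_E K_C^abs(x,F) dλ(x)`. -/
def absComponent (C : Copula) : Measure (I × I) := volume ⊗ₘ absKernel C.markovKernel

/-- `μ_C^dis`, with `μ_C^dis(E × F) = ∫_E K_C^dis(x,F) dλ(x)`. -/
def disComponent (C : Copula) : Measure (I × I) := volume ⊗ₘ disKernel C.markovKernel

/-- `μ_C^sing`, with `μ_C^sing(E × F) = ∫_E K_C^sing(x,F) dλ(x)`. -/
def singComponent (C : Copula) : Measure (I × I) := volume ⊗ₘ singKernel C.markovKernel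

end Copula

/-! ### Williamson measures and Archimedean generators -/

/-- A Williamson measure: a Borel probability measure on `[0,∞)` without mass at `0`. -/
def IsWilliamson (γ : Measure ℝ≥0) : Prop := IsProbabilityMeasure γ ∧ γ {0} = 0

/-- Lebesgue measure on `[0,∞)`. -/
def lebesgue : Measure ℝ≥0 := (volume : Measure ℝ).comap (fun t : ℝ≥0 => (t : ℝ))

/-- An absolutely continuous measure (w.r.t. Lebesgue measure). -/
def IsAbsolutelyContinuous (γ : Measure ℝ≥0) : Prop := γ ≪ lebesgue

/-- A discrete measure: it is carried by a countable set. -/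
def IsDiscrete (γ : Measure ℝ≥0) : Prop := ∃ S : Set ℝ≥0, S.Countable ∧ γ Sᶜ = 0

/-- A singular measure: no point masses, and carried by a Lebesgue null set. -/
def IsSingular (γ : Measure ℝ≥0) : Prop :=
  (∀ t, γ {t} = 0) ∧ ∃ G : Set ℝ≥0, MeasurableSet G ∧ lebesgue G = 0 ∧ γ G = γ univ

/-- The generator `ψ(z) = ∫ (1 - tz)₊ dγ(t)`, `z ∈ [0,∞)`, of a Williamson measure,
extended by `ψ(∞) = 0`. -/
def generator (γ : Measure ℝ≥0) (z : ℝ≥0∞) : ℝ :=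
  if z = ∞ then 0 else ∫ t : ℝ≥0, max (1 - (t : ℝ) * z.toReal) 0 ∂γ

/-- The pseudo-inverse `φ(y) = inf {z ∈ [0,∞] : ψ(z) = y}` of a generator. -/
def pseudoInverse (ψ : ℝ≥0∞ → ℝ) (y : I) : ℝ≥0∞ := sInf {z | ψ z = (y : ℝ)}

/-! ### Pickands dependence measures and functions -/

/-- A Pickands dependence measure: a Borel probability measure on `[0,1]` with mean `1/2`. -/
def IsPickands (ϑ : Measure I) : Prop :=
  IsProbabilityMeasure ϑ ∧ ∫ x : I, (x : ℝ) ∂ϑ = 1 / 2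

/-- The Pickands dependence function `A(t) = 1 - t + 2 ∫_{[0,t]} ϑ([0,z]) dz`, `t ∈ [0,1]`. -/
def pickandsFunction (ϑ : Measure I) (t : ℝ) : ℝ :=
  1 - t + 2 * ∫ z in (0 : ℝ)..t, ϑ.real {x : I | (x : ℝ) ≤ z}

/-- `L = sup {x ∈ [0,1] : ϑ([0,x]) = 0}`, with `sup ∅ = 0`. -/
def lowerEnd (ϑ : Measure I) : ℝ := sSup ((fun x : I => (x : ℝ)) '' {x : I | ϑ (Icc 0 x) = 0})

/-- `R = inf {x ∈ [0,1] : ϑ([0,x]) = 1}`; the set contains `1` if `ϑ` is a probability measure. -/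
def upperEnd (ϑ : Measure I) : ℝ := sInf ((fun x : I => (x : ℝ)) '' {x : I | ϑ (Icc 0 x) = 1})

/-! ### Archimax copulas -/

/-- `C` is the Archimax copula of `γ` and `ϑ`: with the generator `ψ` of `γ`, its pseudo-inverse
`φ` and the Pickands dependence function `A` of `ϑ`,
`C(x,y) = ψ((φ(x) + φ(y)) A(φ(x) / (φ(x) + φ(y))))` for all `x, y ∈ (0,1)`.
(For a Williamson measure `γ` and `x, y ∈ (0,1)`, both `φ(x)` and `φ(y)` lie in `(0,∞)`.) -/
def IsArchimaxCopula (γ : Measure ℝ≥0) (ϑ : Measure I) (C : Copula) : Prop :=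
  ∀ x ∈ Ioo (0 : I) 1, ∀ y ∈ Ioo (0 : I) 1,
    let a := (pseudoInverse (generator γ) x).toReal
    let b := (pseudoInverse (generator γ) y).toReal
    C.cdf x y = generator γ (ENNReal.ofReal ((a + b) * pickandsFunction ϑ (a / (a + b))))

end

end Archimax

/-! Write `ℓ(a,b)` for `tailDep`, so that `ℓ(a,b) = (a+b) A(a/(a+b))` for `a, b > 0`. The copula is
built from a random vector `(a,b)` with survival function `ψ(ℓ(a,b))`; since `ψ` is decreasing,
`(ψ(a), ψ(b))` has the required distribution function. Differentiating `ψ(ℓ(a,b)) = ∫ (1 - tℓ(a,b))₊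
dγ(t)` in `a` shows how to sample: draw `(a,t,s)` with density `2(1-s)t` on `{a > 0, at < 1}` with
respect to `da γ(dt) ϑ(ds)`, and let `b` be the smaller of a radial bound, where `tℓ(a,b)` reaches
`1`, and an angular bound, where `bs` reaches `a(1-s)` (`secondCoord`, `sampleMeasure_survival`).
Uniqueness holds because the distribution function on the open square determines a copula.

On the radial event, where the angular bound is not attained, `tℓ(a,b) = 1` almost surely. For fixed
`a`, this relation between `t` and `y = ψ(b)` is locally bi-Lipschitz, as both `ψ` and `ℓ(a,·)` are
locally bi-Lipschitz on the relevant `b`. It therefore carries Lebesgue null sets to null sets and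
countable sets to countable sets, in both directions (`lebesgue_radialRel`, `volume_radialRel`,
`countable_radialRel_left`, `countable_radialRel_right`), and the type of `γ` passes to the
conditional laws of `radialPart`. Hence the support of `radialPart` lies in that of the component of
the same type.

It remains to see that `radialPart` already has full support (`support_subset_support_radialPart`).
Almost every sample point satisfies `L(a+b) ≤ a ≤ R(a+b)` and `tℓ(a,b) ≤ 1` with `t ∈ supp γ`. As `L
< R`, it is a limit of points with strict inequalities; there `1/ℓ(a,b)` exceeds `t`, so it lies in
the upward closed set `supp γ`, and small boxes in `(a,t,s)` give every neighbourhood positive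
radial mass. The other inclusion is monotonicity of supports, as each component is dominated by
`μ_C`. -/

namespace Archimax

open Filter Topology

/-! ### Disintegration of the copula measure and support criteria for its components. -/

namespace Copula

variable (C : Copula)

lemma measure_eq_compProd : C.measure = volume ⊗ₘ C.markovKernel := by
  conv_lhs => rw [← C.measure.disintegrate C.measure.condKernel]
  rw [markovKernel, Measure.fst, C.map_fst]

lemma measure_apply {E : Set (I × I)} (hE : MeasurableSet E) :
    C.measure E = ∫⁻ x, C.markovKernel x (Prod.mk x ⁻¹' E) := by
  conv_lhs => rw [C.measure_eq_compProd]
  rw [Measure.compProd_apply hE]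

lemma absKernel_add_singularPart (x : I) :
    C.markovKernel x = absKernel C.markovKernel x
      + Kernel.singularPart C.markovKernel (Kernel.const I volume) x := by
  conv_lhs => rw [← Kernel.rnDeriv_add_singularPart C.markovKernel (Kernel.const I volume)]
  rfl

lemma absKernel_le (x : I) : absKernel C.markovKernel x ≤ C.markovKernel x := by
  conv_rhs => rw [C.absKernel_add_singularPart x]
  exact Measure.le_add_right le_rfl

lemma disKernel_le (x : I) : disKernel C.markovKernel x ≤ C.markovKernel x :=
  Measure.restrict_le_self

lemma singKernel_le (x : I) : singKernel C.markovKernel x ≤ C.markovKernel x := by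
  conv_rhs => rw [C.absKernel_add_singularPart x]
  exact Measure.restrict_le_self.trans (Measure.le_add_left le_rfl)

lemma compProd_le {K : Kernel I I} [IsFiniteKernel K] (h : ∀ x, K x ≤ C.markovKernel x) :
    volume ⊗ₘ K ≤ C.measure := by
  refine Measure.le_iff.2 fun E hE => ?_
  rw [Measure.compProd_apply hE, C.measure_apply hE]
  exact lintegral_mono fun x => h x _

lemma absComponent_le : C.absComponent ≤ C.measure := C.compProd_le C.absKernel_le

lemma disComponent_le : C.disComponent ≤ C.measure := C.compProd_le C.disKernel_le

lemma singComponent_le : C.singComponent ≤ C.measure := C.compProd_le C.singKernel_le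

end Copula

lemma absKernel_absolutelyContinuous (K : Kernel I I) [IsFiniteKernel K] (x : I) :
    absKernel K x ≪ volume := by
  rw [absKernel, Kernel.withDensity_apply _ (Kernel.measurable_rnDeriv _ _), Kernel.const_apply]
  exact withDensity_absolutelyContinuous _ _

lemma countable_section_atomSet (K : Kernel I I) [IsFiniteKernel K] (x : I) :
    (Prod.mk x ⁻¹' atomSet K).Countable := by
  have := Measure.countable_meas_pos_of_disjoint_iUnion (μ := K x) (As := fun y : I => {y})
    (fun y => measurableSet_singleton y) (fun a b hab => by simpa using hab)
  refine this.mono fun y hy => ?_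
  exact pos_iff_ne_zero.2 hy

/-- The complement of the support of `ρ` is itself an open `ρ`-null set, so the hypothesis needs to
be applied only once. -/
lemma support_subset_of_null {ν ρ : Measure (I × I)}
    (h : ∀ O : Set (I × I), IsOpen O → ρ O = 0 → ν O = 0) : ν.support ⊆ ρ.support := by
  have h1 := Measure.subset_compl_support_of_isOpen (μ := ν) ρ.isOpen_compl_support
    (h _ ρ.isOpen_compl_support ρ.measure_compl_support)
  exact compl_subset_compl.1 h1

namespace Copula

variable {C : Copula} {ν : Measure (I × I)}

/-- A measure dominated by `μ_C` that does not charge sets with Lebesgue null sections is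
supported in the absolutely continuous component. -/
theorem support_subset_absComponent (hν : ν ≤ C.measure)
    (hnull : ∀ N : Set (I × I), MeasurableSet N → (∀ x, volume (Prod.mk x ⁻¹' N) = 0) → ν N = 0) :
    ν.support ⊆ C.absComponent.support := by
  refine support_subset_of_null fun O hO h0 => ?_
  set N := Kernel.mutuallySingularSet C.markovKernel (Kernel.const I volume) with hN
  have hNm : MeasurableSet N := Kernel.measurableSet_mutuallySingularSet _ _
  have hN0 : ν N = 0 := hnull N hNm fun x =>
    Kernel.measure_mutuallySingularSetSlice C.markovKernel (Kernel.const I volume) x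
  have h1 : C.measure (O \ N) = 0 := by
    rw [← le_zero_iff, ← h0, C.measure_apply (hO.measurableSet.diff hNm), absComponent,
      Measure.compProd_apply hO.measurableSet]
    -- Off the mutually singular set the singular part vanishes, so there the kernel equals its
    -- absolutely continuous part.
    refine lintegral_mono fun x => ?_
    rw [C.absKernel_add_singularPart x, Measure.add_apply,
      Kernel.singularPart_of_subset_compl_mutuallySingularSetSlice, add_zero]
    · exact measure_mono fun y hy => hy.1
    · exact fun y hy => hy.2
  refine measure_mono_null (t := (O \ N) ∪ N) (fun p hp => ?_)
    (measure_union_null (le_zero_iff.1 ((hν _).trans h1.le)) hN0)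
  by_cases hpN : p ∈ N
  · exact Or.inr hpN
  · exact Or.inl ⟨hp, hpN⟩

/-- A measure dominated by `μ_C` that is carried by a set with countable sections is
supported in the discrete component. -/
theorem support_subset_disComponent (hν : ν ≤ C.measure) {E : Set (I × I)} (hE : MeasurableSet E)
    (hνE : ν Eᶜ = 0) (hcount : ∀ x, (Prod.mk x ⁻¹' E).Countable) :
    ν.support ⊆ C.disComponent.support := by
  refine support_subset_of_null fun O hO h0 => ?_
  have h1 : C.measure (O ∩ E) = 0 := by
    rw [← le_zero_iff, ← h0, C.measure_apply (hO.measurableSet.inter hE), disComponent,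
      Measure.compProd_apply hO.measurableSet]
    refine lintegral_mono fun x => ?_
    have hA := measurable_prodMk_left (x := x) (measurableSet_atomSet C.markovKernel)
    rw [disKernel, restrictSections]
    change _ ≤ (C.markovKernel x).restrict (Prod.mk x ⁻¹' atomSet C.markovKernel) _
    rw [Measure.restrict_apply' hA, ← measure_inter_add_sdiff _ hA]
    -- A countable set of non-atoms is null, so on the sections of `E` the kernel is purely
    -- discrete.
    have h2 : C.markovKernel x (Prod.mk x ⁻¹' (O ∩ E) \ Prod.mk x ⁻¹' atomSet C.markovKernel)
        = 0 := by
      have hc : (Prod.mk x ⁻¹' (O ∩ E) \ Prod.mk x ⁻¹' atomSet C.markovKernel).Countable :=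
        (hcount x).mono fun y hy => hy.1.2
      rw [← biUnion_of_singleton (Prod.mk x ⁻¹' (O ∩ E) \ _), measure_biUnion_null_iff hc]
      intro y hy
      by_contra h
      exact hy.2 h
    rw [h2, add_zero]
    exact measure_mono fun y hy => ⟨hy.1.1, hy.2⟩
  refine measure_mono_null (t := (O ∩ E) ∪ Eᶜ) (fun p hp => ?_)
    (measure_union_null (le_zero_iff.1 ((hν _).trans h1.le)) hνE)
  by_cases hpN : p ∈ E
  · exact Or.inl ⟨hp, hpN⟩
  · exact Or.inr hpN

/-- A measure dominated by `μ_C` that is carried by a set with Lebesgue null sections, and does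
not charge sets with countable sections, is supported in the singular component. -/
theorem support_subset_singComponent (hν : ν ≤ C.measure) {E : Set (I × I)} (hE : MeasurableSet E)
    (hνE : ν Eᶜ = 0) (hnull : ∀ x, volume (Prod.mk x ⁻¹' E) = 0)
    (hcount : ∀ N : Set (I × I), MeasurableSet N → (∀ x, (Prod.mk x ⁻¹' N).Countable) →
      ν N = 0) :
    ν.support ⊆ C.singComponent.support := by
  refine support_subset_of_null fun O hO h0 => ?_
  have hA := measurableSet_atomSet C.markovKernel
  have hA0 := hcount _ hA (countable_section_atomSet C.markovKernel)
  have h1 : C.measure ((O ∩ E) \ atomSet C.markovKernel) = 0 := by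
    rw [← le_zero_iff, ← h0, C.measure_apply ((hO.measurableSet.inter hE).diff hA), singComponent,
      Measure.compProd_apply hO.measurableSet]
    refine lintegral_mono fun x => ?_
    have hAx := measurable_prodMk_left (x := x) hA.compl
    rw [singKernel, restrictSections]
    change _ ≤ (Kernel.singularPart C.markovKernel (Kernel.const I volume) x).restrict
      (Prod.mk x ⁻¹' (atomSet C.markovKernel)ᶜ) _
    rw [Measure.restrict_apply' hAx, C.absKernel_add_singularPart x, Measure.add_apply]
    have h2 : absKernel C.markovKernel x
        (Prod.mk x ⁻¹' ((O ∩ E) \ atomSet C.markovKernel)) = 0 :=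
      absKernel_absolutelyContinuous _ x (measure_mono_null (fun y hy => hy.1.2) (hnull x))
    rw [h2, zero_add]
    exact measure_mono fun y hy => ⟨hy.1.1, hy.2⟩
  refine measure_mono_null (t := ((O ∩ E) \ atomSet C.markovKernel) ∪
    (Eᶜ ∪ atomSet C.markovKernel)) (fun p hp => ?_)
    (measure_union_null (le_zero_iff.1 ((hν _).trans h1.le)) (measure_union_null hνE hA0))
  by_cases hpE : p ∈ E
  · by_cases hpA : p ∈ atomSet C.markovKernel
    · exact Or.inr (Or.inr hpA)
    · exact Or.inl ⟨⟨hp, hpE⟩, hpA⟩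
  · exact Or.inr (Or.inl hpE)

end Copula

/-! ### The generator: monotonicity, slopes and inversion. -/

section Generator

/-- The generator of a Williamson measure as a function on `ℝ`, constant on the negative axis. -/
noncomputable def psi (γ : Measure ℝ≥0) (z : ℝ) : ℝ := generator γ (ENNReal.ofReal z)

variable {γ : Measure ℝ≥0}

lemma psi_eq_integral (z : ℝ) : psi γ z = ∫ t : ℝ≥0, max (1 - (t : ℝ) * max z 0) 0 ∂γ := by
  simp [psi, generator, ENNReal.toReal_ofReal']

lemma psi_of_nonneg {z : ℝ} (hz : 0 ≤ z) :
    psi γ z = ∫ t : ℝ≥0, max (1 - (t : ℝ) * z) 0 ∂γ := by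
  rw [psi_eq_integral, max_eq_left hz]

variable [IsProbabilityMeasure γ]

lemma integrable_psi {z : ℝ} (hz : 0 ≤ z) :
    Integrable (fun t : ℝ≥0 => max (1 - (t : ℝ) * z) 0) γ := by
  refine Integrable.of_bound (C := 1) (by fun_prop) (Eventually.of_forall fun t => ?_)
  have : 0 ≤ (t : ℝ) * z := by positivity
  rw [Real.norm_of_nonneg (le_max_right _ _)]
  exact max_le (by linarith) zero_le_one

omit [IsProbabilityMeasure γ] in
lemma psi_nonneg (z : ℝ) : 0 ≤ psi γ z := by
  rw [psi_eq_integral]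
  exact integral_nonneg fun t => le_max_right _ _

lemma psi_antitone : Antitone (psi γ) := by
  intro z w h
  rw [psi_eq_integral, psi_eq_integral]
  refine integral_mono (integrable_psi (le_max_right _ _)) (integrable_psi (le_max_right _ _))
    fun t => ?_
  have h1 : max z 0 ≤ max w 0 := max_le_max_right _ h
  have h2 := mul_le_mul_of_nonneg_left h1 t.coe_nonneg
  exact max_le_max_right _ (by linarith)

lemma psi_zero : psi γ 0 = 1 := by
  simp [psi_of_nonneg le_rfl]

lemma psi_le_one (z : ℝ) : psi γ z ≤ 1 := by
  rcases le_total 0 z with h | h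
  · exact psi_zero (γ := γ) ▸ psi_antitone h
  · have : psi γ z = psi γ 0 := by rw [psi_eq_integral, psi_eq_integral, max_eq_right h, max_self]
    rw [this, psi_zero]

lemma continuous_psi : Continuous (psi γ) := by
  have : psi γ = fun z => ∫ t : ℝ≥0, max (1 - (t : ℝ) * max z 0) 0 ∂γ :=
    funext psi_eq_integral
  rw [this]
  refine continuous_of_dominated (bound := fun _ => 1) (fun z => by fun_prop)
    (fun z => Eventually.of_forall fun t => ?_) (integrable_const _)
    (Eventually.of_forall fun t => by fun_prop)
  have : 0 ≤ (t : ℝ) * max z 0 := mul_nonneg t.coe_nonneg (le_max_right _ _)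
  rw [Real.norm_of_nonneg (le_max_right _ _)]
  exact max_le (by linarith) zero_le_one

omit [IsProbabilityMeasure γ] in
lemma ae_pos (h0 : γ {0} = 0) : ∀ᵐ t ∂γ, 0 < t := by
  rw [ae_iff]
  convert h0 using 2
  ext t
  simp

lemma tendsto_psi_atTop (h0 : γ {0} = 0) : Tendsto (psi γ) atTop (𝓝 0) := by
  have : psi γ = fun z => ∫ t : ℝ≥0, max (1 - (t : ℝ) * max z 0) 0 ∂γ :=
    funext psi_eq_integral
  rw [this]
  have h00 : ∫ t : ℝ≥0, (0 : ℝ) ∂γ = 0 := by simp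
  conv => enter [3, 1]; rw [← h00]
  refine tendsto_integral_filter_of_dominated_convergence (fun _ => 1)
    (Eventually.of_forall fun z => by fun_prop)
    (Eventually.of_forall fun z => Eventually.of_forall fun t => ?_) (integrable_const _) ?_
  · have : 0 ≤ (t : ℝ) * max z 0 := mul_nonneg t.coe_nonneg (le_max_right _ _)
    rw [Real.norm_of_nonneg (le_max_right _ _)]
    exact max_le (by linarith) zero_le_one
  · filter_upwards [ae_pos h0] with t ht
    refine tendsto_const_nhds.congr' ?_
    filter_upwards [eventually_ge_atTop (1 / (t : ℝ))] with z hz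
    have ht' : 0 < (t : ℝ) := ht
    rw [div_le_iff₀ ht'] at hz
    have : z ≤ max z 0 := le_max_left _ _
    rw [max_eq_right]
    nlinarith

/-- A lower bound for the modulus of the slopes of the generator on `[0,b]`. -/
noncomputable def psiSlope (γ : Measure ℝ≥0) (b : ℝ) : ℝ :=
  ∫ t in {t : ℝ≥0 | (t : ℝ) * b < 1}, (t : ℝ) ∂γ

omit [IsProbabilityMeasure γ] in
lemma measurableSet_mul_lt_one (b : ℝ) : MeasurableSet {t : ℝ≥0 | (t : ℝ) * b < 1} :=
  measurableSet_lt (by fun_prop) measurable_const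

lemma integrableOn_psiSlope {b : ℝ} (hb : 0 < b) :
    IntegrableOn (fun t : ℝ≥0 => (t : ℝ)) {t : ℝ≥0 | (t : ℝ) * b < 1} γ := by
  refine Integrable.of_bound (C := 1 / b) (by fun_prop) ?_
  filter_upwards [ae_restrict_mem (measurableSet_mul_lt_one b)] with t ht
  rw [Real.norm_of_nonneg t.coe_nonneg, le_div_iff₀ hb]
  exact le_of_lt ht

/-- For `t * b' < 1` the integrand is linear on `[b, b']` and drops by `t * (b' - b)`; for every
other `t` it does not increase. -/
lemma psi_sub_psi_ge {b b' : ℝ} (hb : 0 ≤ b) (hbb : b < b') :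
    (b' - b) * psiSlope γ b' ≤ psi γ b - psi γ b' := by
  have hb' : 0 < b' := hb.trans_lt hbb
  rw [psi_of_nonneg hb, psi_of_nonneg hb'.le, ← integral_sub (integrable_psi hb)
    (integrable_psi hb'.le), psiSlope, ← integral_indicator (measurableSet_mul_lt_one b'),
    ← integral_const_mul]
  refine integral_mono (((integrableOn_psiSlope hb').integrable_indicator
    (measurableSet_mul_lt_one b')).const_mul _) ((integrable_psi hb).sub
    (integrable_psi hb'.le)) fun t => ?_
  have h1 : (t : ℝ) * b ≤ t * b' := mul_le_mul_of_nonneg_left hbb.le t.coe_nonneg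
  by_cases ht : (t : ℝ) * b' < 1
  · simp only [indicator, mem_ofPred_eq, ht, if_true]
    rw [max_eq_left (by linarith), max_eq_left (by linarith)]
    linarith
  · simp only [indicator, mem_ofPred_eq, ht, if_false]
    rw [max_eq_right (a := 1 - (t : ℝ) * b') (by linarith)]
    simp

/-- Integrands with `t ≥ 1 / c` vanish at both points, and the others have slope at most `1 / c` in
modulus. -/
lemma abs_psi_sub_le {c b b' : ℝ} (hc : 0 < c) (hb : c ≤ b) (hb' : c ≤ b') :
    |psi γ b - psi γ b'| ≤ |b - b'| / c := by
  rw [psi_of_nonneg (hc.le.trans hb), psi_of_nonneg (hc.le.trans hb'),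
    ← integral_sub (integrable_psi (hc.le.trans hb)) (integrable_psi (hc.le.trans hb')),
    ← Real.norm_eq_abs]
  refine (norm_integral_le_of_norm_le_const (C := |b - b'| / c)
    (Eventually.of_forall fun t => ?_)).trans (by simp)
  rw [Real.norm_eq_abs]
  by_cases ht : (t : ℝ) * c < 1
  · have h1 : (t : ℝ) ≤ 1 / c := by rw [le_div_iff₀ hc]; exact ht.le
    refine (abs_max_sub_max_le_abs _ _ _).trans ?_
    rw [show 1 - (t : ℝ) * b - (1 - t * b') = -(t * (b - b')) by ring, abs_neg, abs_mul,
      abs_of_nonneg t.coe_nonneg, div_eq_inv_mul, ← one_div]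
    exact mul_le_mul_of_nonneg_right h1 (abs_nonneg _)
  · have h1 := mul_le_mul_of_nonneg_left hb t.coe_nonneg
    have h2 := mul_le_mul_of_nonneg_left hb' t.coe_nonneg
    rw [max_eq_right (by linarith), max_eq_right (by linarith)]
    simp only [sub_self, abs_zero]
    positivity

lemma psiSlope_pos (h0 : γ {0} = 0) {b : ℝ} (hb : 0 < b) (h : 0 < psi γ b) :
    0 < psiSlope γ b := by
  rw [psiSlope, setIntegral_pos_iff_support_of_nonneg_ae (Eventually.of_forall fun t =>
    t.coe_nonneg) (integrableOn_psiSlope hb)]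
  by_contra hcon
  have hz : γ ((Function.support fun t : ℝ≥0 => (t : ℝ)) ∩ {t : ℝ≥0 | (t : ℝ) * b < 1}) = 0 :=
    le_zero_iff.1 (not_lt.1 hcon)
  refine h.ne' ?_
  rw [psi_of_nonneg hb.le]
  refine integral_eq_zero_of_ae ?_
  filter_upwards [ae_pos h0, measure_eq_zero_iff_ae_notMem.1 hz] with t ht ht'
  have : ¬ (t : ℝ) * b < 1 := fun h => ht' ⟨by simpa using ht.ne', h⟩
  exact max_eq_right (by linarith)

lemma psi_strict (h0 : γ {0} = 0) {z w : ℝ} (hz : 0 ≤ z) (hzw : z < w) (h : 0 < psi γ z) :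
    psi γ w < psi γ z := by
  rcases (psi_nonneg (γ := γ) w).eq_or_lt with h1 | h1
  · rwa [← h1]
  · have := psi_sub_psi_ge (γ := γ) hz hzw
    have := mul_pos (sub_pos.2 hzw) (psiSlope_pos h0 (hz.trans_lt hzw) h1)
    linarith

lemma psi_lt_psi_iff (h0 : γ {0} = 0) {z w : ℝ} (hz : 0 ≤ z) (h : 0 < psi γ z) :
    psi γ w < psi γ z ↔ z < w :=
  ⟨fun h1 => lt_of_not_ge fun h2 => absurd (psi_antitone h2) (not_le.2 h1),
    fun h1 => psi_strict h0 hz h1 h⟩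

lemma psi_injOn (h0 : γ {0} = 0) {z w : ℝ} (hz : 0 ≤ z) (hw : 0 ≤ w) (h : 0 < psi γ z)
    (hzw : psi γ z = psi γ w) : z = w := by
  rcases lt_trichotomy z w with h1 | h1 | h1
  · exact absurd (psi_strict h0 hz h1 h) (by rw [hzw]; exact lt_irrefl _)
  · exact h1
  · exact absurd (psi_strict h0 hw h1 (hzw ▸ h)) (by rw [hzw]; exact lt_irrefl _)

lemma exists_psi_eq (h0 : γ {0} = 0) {y : ℝ} (hy : 0 < y) (hy1 : y ≤ 1) :
    ∃ z, 0 ≤ z ∧ psi γ z = y := by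
  obtain ⟨w, hw, hw0⟩ := (((tendsto_psi_atTop h0).eventually_lt_const hy).and
    (eventually_ge_atTop (0 : ℝ))).exists
  obtain ⟨z, hz, hzy⟩ := intermediate_value_Icc' hw0 (continuous_psi (γ := γ)).continuousOn
    ⟨hw.le, by rwa [psi_zero]⟩
  exact ⟨z, hz.1, hzy⟩

/-- A positive level is attained exactly once: `ψ` is injective where positive, and `∞` is excluded
by `ψ(∞) = 0`. The infimum is thus over a singleton. -/
lemma toReal_pseudoInverse (h0 : γ {0} = 0) {y : I} {z : ℝ} (hz : 0 ≤ z) (hy : 0 < y)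
    (h : psi γ z = y) : (pseudoInverse (generator γ) y).toReal = z := by
  have hy' : 0 < (y : ℝ) := hy
  have : {w : ℝ≥0∞ | generator γ w = y} = {ENNReal.ofReal z} := by
    ext w
    simp only [mem_ofPred_eq, mem_singleton_iff]
    constructor
    · intro hw
      have hw' : w ≠ ∞ := by
        rintro rfl
        simp only [generator, if_true] at hw
        exact hy'.ne hw
      rw [← ENNReal.ofReal_toReal hw'] at hw ⊢
      congr 1
      refine (psi_injOn h0 hz ENNReal.toReal_nonneg (h ▸ hy') ?_).symm
      rw [h, ← hw, psi]
    · rintro rfl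
      exact h
  rw [pseudoInverse, this, sInf_singleton, ENNReal.toReal_ofReal hz]

end Generator

/-! ### The stable tail dependence function. -/

section Pickands

/-- The stable tail dependence function of a Pickands dependence measure. -/
noncomputable def tailDep (ϑ : Measure I) (a b : ℝ) : ℝ :=
  ∫ s : I, 2 * max (a * (1 - (s : ℝ))) (b * s) ∂ϑ

variable {ϑ : Measure I} [IsProbabilityMeasure ϑ]

lemma integrable_of_continuous {f : I → ℝ} (hf : Continuous f) : Integrable f ϑ := by
  rw [← integrableOn_univ]
  exact hf.continuousOn.integrableOn_compact isCompact_univ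

lemma continuous_tailDep : Continuous fun p : ℝ × ℝ => tailDep ϑ p.1 p.2 := by
  have := continuous_parametric_integral_of_continuous (μ := ϑ)
    (f := fun (p : ℝ × ℝ) (s : I) => 2 * max (p.1 * (1 - (s : ℝ))) (p.2 * s))
    (by simp only [Function.uncurry_def]; fun_prop) isCompact_univ
  simpa [tailDep] using this

lemma tailDep_mono {a a' b b' : ℝ} (ha : a ≤ a') (hb : b ≤ b') :
    tailDep ϑ a b ≤ tailDep ϑ a' b' := by
  refine integral_mono (integrable_of_continuous (by fun_prop))
    (integrable_of_continuous (by fun_prop)) fun s => ?_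
  have h1 := mul_le_mul_of_nonneg_right ha (sub_nonneg.2 s.2.2)
  have h2 := mul_le_mul_of_nonneg_right hb s.2.1
  exact mul_le_mul_of_nonneg_left (max_le_max h1 h2) zero_le_two

omit [IsProbabilityMeasure ϑ] in
lemma tailDep_smul {c : ℝ} (hc : 0 ≤ c) (a b : ℝ) :
    tailDep ϑ (c * a) (c * b) = c * tailDep ϑ a b := by
  rw [tailDep, tailDep, ← integral_const_mul]
  refine integral_congr_ae (Eventually.of_forall fun s => ?_)
  simp only [mul_assoc, ← mul_max_of_nonneg _ _ hc]
  ring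

lemma integral_two_mul_one_sub (hϑ : ∫ x : I, (x : ℝ) ∂ϑ = 1 / 2) (a : ℝ) :
    ∫ s : I, 2 * (a * (1 - (s : ℝ))) ∂ϑ = a := by
  rw [integral_const_mul, integral_const_mul, integral_sub (integrable_const _)
    (integrable_of_continuous (by fun_prop)), hϑ]
  simp
  ring

omit [IsProbabilityMeasure ϑ] in
lemma integral_two_mul (hϑ : ∫ x : I, (x : ℝ) ∂ϑ = 1 / 2) (b : ℝ) :
    ∫ s : I, 2 * (b * (s : ℝ)) ∂ϑ = b := by
  rw [integral_const_mul, integral_const_mul, hϑ]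
  ring

lemma tailDep_zero_right (hϑ : ∫ x : I, (x : ℝ) ∂ϑ = 1 / 2) {a : ℝ} (ha : 0 ≤ a) :
    tailDep ϑ a 0 = a := by
  rw [tailDep]
  conv_rhs => rw [← integral_two_mul_one_sub hϑ a]
  refine integral_congr_ae (Eventually.of_forall fun s => ?_)
  have := mul_nonneg ha (sub_nonneg.2 s.2.2)
  simp [this]

omit [IsProbabilityMeasure ϑ] in
lemma tailDep_zero_left (hϑ : ∫ x : I, (x : ℝ) ∂ϑ = 1 / 2) {b : ℝ} (hb : 0 ≤ b) :
    tailDep ϑ 0 b = b := by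
  rw [tailDep]
  conv_rhs => rw [← integral_two_mul hϑ b]
  refine integral_congr_ae (Eventually.of_forall fun s => ?_)
  have := mul_nonneg hb s.2.1
  simp [this]

lemma le_tailDep_left (hϑ : ∫ x : I, (x : ℝ) ∂ϑ = 1 / 2) {a b : ℝ} (ha : 0 ≤ a) (hb : 0 ≤ b) :
    a ≤ tailDep ϑ a b := by
  conv_lhs => rw [← tailDep_zero_right hϑ ha]
  exact tailDep_mono le_rfl hb

lemma le_tailDep_right (hϑ : ∫ x : I, (x : ℝ) ∂ϑ = 1 / 2) {a b : ℝ} (ha : 0 ≤ a) (hb : 0 ≤ b) :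
    b ≤ tailDep ϑ a b := by
  conv_lhs => rw [← tailDep_zero_left hϑ hb]
  exact tailDep_mono ha le_rfl

/-- A lower bound for the slopes of `tailDep ϑ a` on `[b,∞)`. -/
noncomputable def tailSlope (ϑ : Measure I) (a b : ℝ) : ℝ :=
  ∫ s in {s : I | a * (1 - (s : ℝ)) < b * s}, 2 * (s : ℝ) ∂ϑ

omit [IsProbabilityMeasure ϑ] in
lemma measurableSet_tailSlope (a b : ℝ) : MeasurableSet {s : I | a * (1 - (s : ℝ)) < b * s} :=
  measurableSet_lt (by fun_prop) (by fun_prop)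

/-- Where `b * s` dominates the maximum it keeps dominating at `b'`, which gives slope `2 * s`;
elsewhere the integrand does not decrease. -/
lemma tailDep_sub_ge {a b b' : ℝ} (hbb : b ≤ b') :
    (b' - b) * tailSlope ϑ a b ≤ tailDep ϑ a b' - tailDep ϑ a b := by
  have h2 : Integrable (fun s : I => 2 * (s : ℝ)) ϑ := integrable_of_continuous (by fun_prop)
  rw [tailDep, tailDep, ← integral_sub (integrable_of_continuous (by fun_prop))
    (integrable_of_continuous (by fun_prop)), tailSlope,
    ← integral_indicator (measurableSet_tailSlope a b), ← integral_const_mul]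
  refine integral_mono ((h2.indicator (measurableSet_tailSlope a b)).const_mul _)
    (integrable_of_continuous (by fun_prop)) fun s => ?_
  have h1 : b * (s : ℝ) ≤ b' * s := mul_le_mul_of_nonneg_right hbb s.2.1
  by_cases hs : a * (1 - (s : ℝ)) < b * s
  · simp only [indicator, mem_ofPred_eq, hs, if_true]
    rw [max_eq_right hs.le, max_eq_right (hs.le.trans h1)]
    linarith
  · simp only [indicator, mem_ofPred_eq, hs, if_false]
    have := max_le_max_left (a * (1 - (s : ℝ))) h1
    linarith

lemma tailDep_sub_le (hϑ : ∫ x : I, (x : ℝ) ∂ϑ = 1 / 2) {a b b' : ℝ} (hbb : b ≤ b') :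
    tailDep ϑ a b' - tailDep ϑ a b ≤ b' - b := by
  rw [tailDep, tailDep, ← integral_sub (integrable_of_continuous (by fun_prop))
    (integrable_of_continuous (by fun_prop))]
  conv_rhs => rw [← integral_two_mul hϑ (b' - b)]
  refine integral_mono (integrable_of_continuous (by fun_prop))
    (integrable_of_continuous (by fun_prop)) fun s => ?_
  have h1 : b * (s : ℝ) ≤ b' * s := mul_le_mul_of_nonneg_right hbb s.2.1
  have h2 : max (a * (1 - (s : ℝ))) (b' * s) ≤ max (a * (1 - (s : ℝ))) (b * s) +
      (b' - b) * s := by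
    refine max_le ?_ ?_
    · have := le_max_left (a * (1 - (s : ℝ))) (b * s)
      linarith
    · have := le_max_right (a * (1 - (s : ℝ))) (b * s)
      linarith
  simp only
  linarith

/-- The mean `1/2` gives `a = ∫ 2a(1-s) dϑ`, so `ℓ(a,b)` can exceed `a` only through angles at which
`bs` wins the maximum. -/
lemma measure_pos_of_lt_tailDep (hϑ : ∫ x : I, (x : ℝ) ∂ϑ = 1 / 2) {a b : ℝ}
    (h : a < tailDep ϑ a b) : 0 < ϑ {s : I | a * (1 - (s : ℝ)) < b * s} := by
  by_contra hcon
  have hz := measure_eq_zero_iff_ae_notMem.1 (le_zero_iff.1 (not_lt.1 hcon))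
  refine h.ne ?_
  rw [tailDep]
  conv_lhs => rw [← integral_two_mul_one_sub hϑ a]
  refine integral_congr_ae ?_
  filter_upwards [hz] with s hs
  rw [max_eq_left (not_lt.1 hs)]

lemma tailSlope_pos {a b : ℝ} (ha : 0 ≤ a)
    (h : 0 < ϑ {s : I | a * (1 - (s : ℝ)) < b * s}) : 0 < tailSlope ϑ a b := by
  have h2 : Integrable (fun s : I => 2 * (s : ℝ)) ϑ := integrable_of_continuous (by fun_prop)
  rw [tailSlope, setIntegral_pos_iff_support_of_nonneg_ae (Eventually.of_forall fun s =>
    mul_nonneg zero_le_two s.2.1) h2.integrableOn]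
  refine h.trans_le (measure_mono fun s hs => ⟨?_, hs⟩)
  intro h0
  have h0' : (s : ℝ) = 0 := by simpa using h0
  have hs' : a * (1 - (s : ℝ)) < b * s := hs
  rw [h0'] at hs'
  linarith

lemma lt_tailDep_of_measure_pos (hϑ : ∫ x : I, (x : ℝ) ∂ϑ = 1 / 2) {a b : ℝ}
    (h : 0 < ϑ {s : I | a * (1 - (s : ℝ)) < b * s}) : a < tailDep ϑ a b := by
  have hi : Integrable (fun s : I => max (a * (1 - (s : ℝ))) (b * s) - a * (1 - (s : ℝ))) ϑ :=
    integrable_of_continuous (by fun_prop)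
  have h1 : 0 < ∫ s : I, (max (a * (1 - (s : ℝ))) (b * s) - a * (1 - (s : ℝ))) ∂ϑ := by
    rw [integral_pos_iff_support_of_nonneg (fun s => sub_nonneg.2 (le_max_left _ _)) hi]
    refine h.trans_le (measure_mono fun s hs => ?_)
    have hs' : a * (1 - (s : ℝ)) < b * s := hs
    exact (sub_pos.2 (lt_max_of_lt_right hs')).ne'
  rw [integral_sub (integrable_of_continuous (by fun_prop))
    (integrable_of_continuous (by fun_prop))] at h1
  have h3 := integral_two_mul_one_sub hϑ a
  rw [integral_const_mul] at h3
  rw [tailDep, integral_const_mul]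
  linarith

/-- The Pickands dependence function in terms of the tail dependence function. -/
lemma mul_pickandsFunction (hϑ : ∫ x : I, (x : ℝ) ∂ϑ = 1 / 2) {a b : ℝ} (ha : 0 < a)
    (hb : 0 < b) : (a + b) * pickandsFunction ϑ (a / (a + b)) = tailDep ϑ a b := by
  have hab : 0 < a + b := by positivity
  set t := a / (a + b) with ht
  have ht0 : 0 ≤ t := by positivity
  have hat : a = (a + b) * t := by rw [ht]; field_simp
  have hbt : b = (a + b) * (1 - t) := by rw [ht]; field_simp; ring
  -- Fubini: the integrated distribution function is the mean of `(t - x)₊`.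
  have key : ∫ z in (0 : ℝ)..t, ϑ.real {x : I | (x : ℝ) ≤ z} = ∫ x : I, max (t - (x : ℝ)) 0 ∂ϑ := by
    have h1 : ∀ z : ℝ, ϑ.real {x : I | (x : ℝ) ≤ z} =
        ∫ x : I, ({p : ℝ × I | (p.2 : ℝ) ≤ p.1}.indicator (fun _ => (1 : ℝ))) (z, x) ∂ϑ := by
      intro z
      have hm : MeasurableSet {x : I | (x : ℝ) ≤ z} :=
        measurableSet_le (by fun_prop) measurable_const
      rw [← integral_indicator_one hm]
      rfl
    simp_rw [h1]
    rw [intervalIntegral.integral_of_le ht0]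
    have hm : MeasurableSet {p : ℝ × I | (p.2 : ℝ) ≤ p.1} :=
      measurableSet_le (by fun_prop) (by fun_prop)
    rw [integral_integral_swap]
    · refine integral_congr_ae (Eventually.of_forall fun x => ?_)
      have h2 : (fun z : ℝ => ({p : ℝ × I | (p.2 : ℝ) ≤ p.1}.indicator (fun _ => (1 : ℝ))) (z, x))
          = (Ici (x : ℝ)).indicator 1 := rfl
      beta_reduce
      rw [h2, integral_indicator_one measurableSet_Ici, measureReal_def,
        Measure.restrict_apply measurableSet_Ici]
      have h3 : volume (Ici (x : ℝ) ∩ Ioc 0 t) = ENNReal.ofReal (t - x) := by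
        have hs : Ioi (x : ℝ) ∩ Ioc 0 t = Ioc (x : ℝ) t := by
          ext z
          simp only [mem_inter_iff, mem_Ioi, mem_Ioc]
          have := x.2.1
          constructor
          · rintro ⟨h, h', h''⟩; exact ⟨h, h''⟩
          · rintro ⟨h, h'⟩; exact ⟨h, this.trans_lt h, h'⟩
        rw [← Real.volume_Ioc, ← hs]
        exact measure_congr ((Ioi_ae_eq_Ici (a := (x : ℝ))).symm.inter (ae_eq_refl _))
      rw [h3, ENNReal.toReal_ofReal']
    · refine Integrable.of_bound (C := 1)
        ((measurable_const.indicator hm).aestronglyMeasurable) (Eventually.of_forall fun p => ?_)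
      exact (norm_indicator_le_norm_self (fun _ => (1 : ℝ)) p).trans_eq norm_one
  rw [pickandsFunction, key, tailDep]
  have h4 : ∀ s : I, 2 * max (a * (1 - (s : ℝ))) (b * s) =
      (a + b) * (2 * ((1 - t) * (s : ℝ)) + 2 * max (t - (s : ℝ)) 0) := by
    intro s
    have h5 : max (a * (1 - (s : ℝ))) (b * s) = (a + b) * max (t * (1 - s)) ((1 - t) * s) := by
      rw [mul_max_of_nonneg _ _ hab.le, ← mul_assoc, ← mul_assoc, ← hat, ← hbt]
    have h6 : max (t * (1 - (s : ℝ))) ((1 - t) * s) = (1 - t) * s + max (t - (s : ℝ)) 0 := by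
      rw [← max_add_add_left]
      congr 1 <;> ring
    rw [h5, h6]
    ring
  simp_rw [h4]
  rw [integral_const_mul, integral_add (integrable_of_continuous (by fun_prop))
    (integrable_of_continuous (by fun_prop)), integral_two_mul hϑ, integral_const_mul]

end Pickands

/-- The strict sublevel set is an open half-line. This turns the radial constraint `tℓ(x,b) < 1`
into `x < c` when the first coordinate is integrated out. -/
lemma _root_.Monotone.exists_threshold {f : ℝ → ℝ} (hm : Monotone f) (hf : Continuous f)
    {a d r : ℝ} (ha : f a < r) (hd : r ≤ f d) : ∃ c, f c = r ∧ ∀ x, f x < r ↔ x < c := by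
  have hbdd : BddAbove {x | f x < r} := ⟨d, fun x hx =>
    (lt_of_not_ge fun h => absurd (hm h) (not_le.2 (lt_of_lt_of_le hx hd))).le⟩
  have hne : {x | f x < r}.Nonempty := ⟨a, ha⟩
  have hiff : ∀ x, f x < r ↔ x < sSup {x | f x < r} := by
    intro x
    constructor
    · intro hx
      have h1 : ∀ᶠ y in 𝓝[>] x, f y < r :=
        (hf.continuousAt.eventually_lt_const hx).filter_mono nhdsWithin_le_nhds
      obtain ⟨y, hy, hxy⟩ := (h1.and self_mem_nhdsWithin).exists
      exact lt_of_lt_of_le hxy (le_csSup hbdd hy)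
    · intro hx
      obtain ⟨y, hy, hxy⟩ := exists_lt_of_lt_csSup hne hx
      exact (hm hxy.le).trans_lt hy
  refine ⟨_, le_antisymm ?_ (not_lt.1 fun h => lt_irrefl _ ((hiff _).1 h)), hiff⟩
  refine le_of_tendsto (hf.continuousAt.tendsto.mono_left nhdsWithin_le_nhds :
    Tendsto f (𝓝[<] (sSup {x | f x < r})) _) ?_
  filter_upwards [self_mem_nhdsWithin] with x hx
  exact ((hiff x).2 hx).le

/-! ### The random vector with survival function `ψ(ℓ(a,b))`. -/

section Sampling

variable (γ : Measure ℝ≥0) (ϑ : Measure I)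

/-- The second coordinate `b` of the random vector with survival function
`ψ (tailDep a b)`, as a function of the first coordinate `a`, the radial variable `t` and
the angular variable `s`. -/
noncomputable def secondCoord (ω : ℝ × ℝ≥0 × I) : ℝ :=
  sSup {b | 0 ≤ b ∧ 0 < ω.1 ∧ 0 < ω.2.1 ∧ (ω.2.1 : ℝ) * tailDep ϑ ω.1 b < 1 ∧
    b * ω.2.2 < ω.1 * (1 - (ω.2.2 : ℝ))}

noncomputable def baseMeasure : Measure (ℝ × ℝ≥0 × I) := (volume : Measure ℝ).prod (γ.prod ϑ)

/-- The factor is `t` times the `a`-derivative of `2 * max (a(1-s)) (bs)` where the first term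
dominates; `a * t < 1` is the radial constraint at `b = 0`, as `ℓ(a,0) = a`. -/
noncomputable def sampleDensity (ω : ℝ × ℝ≥0 × I) : ℝ≥0∞ :=
  {ω : ℝ × ℝ≥0 × I | 0 < ω.1 ∧ ω.1 * ω.2.1 < 1}.indicator
    (fun ω => ENNReal.ofReal (2 * (1 - (ω.2.2 : ℝ)) * ω.2.1)) ω

/-- The joint law of the first coordinate, the radial and the angular variable. -/
noncomputable def sampleMeasure : Measure (ℝ × ℝ≥0 × I) :=
  (baseMeasure γ ϑ).withDensity sampleDensity

variable {γ ϑ}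

lemma measurable_sampleDensity : Measurable sampleDensity := by
  refine Measurable.indicator (by fun_prop) ?_
  have m1 : MeasurableSet {ω : ℝ × ℝ≥0 × I | 0 < ω.1} := measurableSet_lt (by fun_prop) (by fun_prop)
  have m2 : MeasurableSet {ω : ℝ × ℝ≥0 × I | ω.1 * ω.2.1 < 1} :=
    measurableSet_lt (by fun_prop) (by fun_prop)
  exact m1.inter m2

lemma ae_baseMeasure_of_sampleMeasure {p : ℝ × ℝ≥0 × I → Prop}
    (h : ∀ᵐ ω ∂baseMeasure γ ϑ, p ω) : ∀ᵐ ω ∂sampleMeasure γ ϑ, p ω :=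
  (withDensity_absolutelyContinuous _ _).ae_le h

lemma sampleDensity_ne_zero {ω : ℝ × ℝ≥0 × I} :
    sampleDensity ω ≠ 0 ↔ 0 < ω.1 ∧ ω.1 * ω.2.1 < 1 ∧ 0 < ω.2.1 ∧ (ω.2.2 : ℝ) < 1 := by
  unfold sampleDensity
  by_cases h : 0 < ω.1 ∧ ω.1 * ω.2.1 < 1
  · rw [indicator_of_mem (by exact h)]
    simp only [ne_eq, ENNReal.ofReal_eq_zero, not_le, h.1, h.2, true_and]
    have h1 : 0 ≤ 1 - (ω.2.2 : ℝ) := sub_nonneg.2 ω.2.2.2.2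
    constructor
    · intro hp
      refine ⟨pos_iff_ne_zero.2 fun h0 => ?_, lt_of_not_ge fun h2 => ?_⟩
      · rw [h0] at hp; simp at hp
      · have : 1 - (ω.2.2 : ℝ) = 0 := le_antisymm (by linarith) h1
        rw [this] at hp; simp at hp
    · rintro ⟨h2, h3⟩
      have h2' : 0 < (ω.2.1 : ℝ) := h2
      have : 0 < 1 - (ω.2.2 : ℝ) := sub_pos.2 h3
      positivity
  · rw [indicator_of_notMem (by exact h)]
    simp only [ne_eq, not_true_eq_false, false_iff]
    exact fun h' => h ⟨h'.1, h'.2.1⟩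

lemma ae_sampleMeasure : ∀ᵐ ω ∂sampleMeasure γ ϑ,
    0 < ω.1 ∧ ω.1 * (ω.2.1 : ℝ) < 1 ∧ 0 < ω.2.1 ∧ (ω.2.2 : ℝ) < 1 := by
  rw [sampleMeasure, ae_withDensity_iff measurable_sampleDensity]
  exact Eventually.of_forall fun ω h => sampleDensity_ne_zero.1 h

variable [IsProbabilityMeasure ϑ]

omit [IsProbabilityMeasure ϑ] in
lemma secondCoord_nonneg (ω : ℝ × ℝ≥0 × I) : 0 ≤ secondCoord ϑ ω :=
  Real.sSup_nonneg fun _ hb => hb.1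

/-- The constraints are open and inherited by smaller `b`, so the supremum is not admissible itself.
Since `b ≤ ℓ(a,b)`, admissible `b` are bounded by `1/t`. -/
lemma lt_secondCoord (hϑ : ∫ x : I, (x : ℝ) ∂ϑ = 1 / 2) {ω : ℝ × ℝ≥0 × I} {b : ℝ} (hb : 0 ≤ b) :
    b < secondCoord ϑ ω ↔ 0 < ω.1 ∧ 0 < ω.2.1 ∧ (ω.2.1 : ℝ) * tailDep ϑ ω.1 b < 1 ∧
      b * ω.2.2 < ω.1 * (1 - (ω.2.2 : ℝ)) := by
  constructor
  · intro h
    obtain ⟨y, ⟨_, h1, h2, h3, h4⟩, hby⟩ := exists_lt_of_lt_csSup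
      -- The supremum of the empty set is `0`, which cannot exceed `b ≥ 0`.
      (by by_contra hne; rw [secondCoord, not_nonempty_iff_eq_empty.1 hne] at h; simp at h; linarith)
      h
    refine ⟨h1, h2, ?_, ?_⟩
    · exact (mul_le_mul_of_nonneg_left (tailDep_mono le_rfl hby.le) ω.2.1.coe_nonneg).trans_lt h3
    · exact (mul_le_mul_of_nonneg_right hby.le ω.2.2.2.1).trans_lt h4
  · rintro ⟨h1, h2, h3, h4⟩
    have h2' : 0 < (ω.2.1 : ℝ) := h2
    have c1 : Continuous fun y => (ω.2.1 : ℝ) * tailDep ϑ ω.1 y :=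
      continuous_const.mul (continuous_tailDep.comp (by fun_prop : Continuous fun y : ℝ => (ω.1, y)))
    have c2 : Continuous fun y : ℝ => y * (ω.2.2 : ℝ) := by fun_prop
    have h5 : ∀ᶠ y in 𝓝[>] b, (ω.2.1 : ℝ) * tailDep ϑ ω.1 y < 1 ∧
        y * ω.2.2 < ω.1 * (1 - (ω.2.2 : ℝ)) :=
      ((c1.continuousAt.eventually_lt_const h3).and
        (c2.continuousAt.eventually_lt_const h4)).filter_mono nhdsWithin_le_nhds
    obtain ⟨y, ⟨hy1, hy2⟩, hby⟩ := (h5.and self_mem_nhdsWithin).exists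
    have hby' : b < y := hby
    refine lt_of_lt_of_le hby' (le_csSup ⟨1 / ω.2.1, ?_⟩ ⟨hb.trans hby'.le, h1, h2, hy1, hy2⟩)
    rintro z ⟨hz0, _, _, hz, _⟩
    rw [le_div_iff₀ h2', mul_comm]
    exact (mul_le_mul_of_nonneg_left (le_tailDep_right hϑ h1.le hz0) h2'.le).trans hz.le

lemma measurableSet_tailDep_lt (b : ℝ) : MeasurableSet {ω : ℝ × ℝ≥0 × I |
    (ω.2.1 : ℝ) * tailDep ϑ ω.1 b < 1 ∧ b * ω.2.2 < ω.1 * (1 - (ω.2.2 : ℝ))} := by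
  have hm : Measurable fun ω : ℝ × ℝ≥0 × I => tailDep ϑ ω.1 b :=
    (continuous_tailDep.comp
      (by fun_prop : Continuous fun ω : ℝ × ℝ≥0 × I => (ω.1, b))).measurable
  have m1 : MeasurableSet {ω : ℝ × ℝ≥0 × I | (ω.2.1 : ℝ) * tailDep ϑ ω.1 b < 1} :=
    measurableSet_lt (Measurable.mul (by fun_prop) hm) measurable_const
  have m2 : MeasurableSet {ω : ℝ × ℝ≥0 × I | b * ω.2.2 < ω.1 * (1 - (ω.2.2 : ℝ))} :=
    measurableSet_lt (by fun_prop) (by fun_prop)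
  exact m1.inter m2

lemma measurable_secondCoord (hϑ : ∫ x : I, (x : ℝ) ∂ϑ = 1 / 2) :
    Measurable (secondCoord ϑ) := by
  refine measurable_of_Ioi fun b => ?_
  rcases lt_or_ge b 0 with hb | hb
  · convert MeasurableSet.univ
    exact eq_univ_of_forall fun ω => hb.trans_le (secondCoord_nonneg ω)
  · have : secondCoord ϑ ⁻¹' Ioi b = {ω | 0 < ω.1 ∧ 0 < ω.2.1 ∧
        (ω.2.1 : ℝ) * tailDep ϑ ω.1 b < 1 ∧ b * ω.2.2 < ω.1 * (1 - (ω.2.2 : ℝ))} := by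
      ext ω
      exact lt_secondCoord hϑ hb
    rw [this]
    have m1 : MeasurableSet {ω : ℝ × ℝ≥0 × I | 0 < ω.1} :=
      measurableSet_lt (by fun_prop) (by fun_prop)
    have m2 : MeasurableSet {ω : ℝ × ℝ≥0 × I | 0 < ω.2.1} :=
      measurableSet_lt (by fun_prop) (by fun_prop)
    exact m1.inter (m2.inter (measurableSet_tailDep_lt b))

/-- On the event that the second coordinate is not given by the angle, it is given by the
radius. -/
lemma mul_tailDep_secondCoord (hϑ : ∫ x : I, (x : ℝ) ∂ϑ = 1 / 2) {ω : ℝ × ℝ≥0 × I}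
    (h1 : 0 < ω.1) (h2 : 0 < ω.2.1)
    (h3 : secondCoord ϑ ω * ω.2.2 < ω.1 * (1 - (ω.2.2 : ℝ))) :
    1 ≤ (ω.2.1 : ℝ) * tailDep ϑ ω.1 (secondCoord ϑ ω) :=
  not_lt.1 fun h => lt_irrefl _ ((lt_secondCoord hϑ (secondCoord_nonneg ω)).2 ⟨h1, h2, h, h3⟩)

lemma secondCoord_spec (hϑ : ∫ x : I, (x : ℝ) ∂ϑ = 1 / 2) {ω : ℝ × ℝ≥0 × I}
    (h : 0 < secondCoord ϑ ω) :
    (ω.2.1 : ℝ) * tailDep ϑ ω.1 (secondCoord ϑ ω) ≤ 1 ∧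
      secondCoord ϑ ω * ω.2.2 ≤ ω.1 * (1 - (ω.2.2 : ℝ)) := by
  have c1 : Continuous fun y => (ω.2.1 : ℝ) * tailDep ϑ ω.1 y :=
    continuous_const.mul (continuous_tailDep.comp (by fun_prop : Continuous fun y : ℝ => (ω.1, y)))
  have c2 : Continuous fun y : ℝ => y * (ω.2.2 : ℝ) := by fun_prop
  have h5 : ∀ᶠ y in 𝓝[<] secondCoord ϑ ω, (ω.2.1 : ℝ) * tailDep ϑ ω.1 y < 1 ∧
        y * ω.2.2 < ω.1 * (1 - (ω.2.2 : ℝ)) := by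
    filter_upwards [self_mem_nhdsWithin,
      (eventually_gt_nhds h).filter_mono nhdsWithin_le_nhds] with y hy hy0
    exact ((lt_secondCoord hϑ hy0.le).1 hy).2.2
  exact ⟨le_of_tendsto (c1.continuousAt.tendsto.mono_left nhdsWithin_le_nhds)
      (h5.mono fun y hy => hy.1.le),
    le_of_tendsto (c2.continuousAt.tendsto.mono_left nhdsWithin_le_nhds)
      (h5.mono fun y hy => hy.2.le)⟩

/-- For `s < 1` the section is the interval from `max a q` to `c` with `q = bs/(1-s)`, so weight
times length is an increment of the integrand of `ℓ(·,b)`; for `s = 1` both sides vanish. -/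
lemma volume_section_mul {a b c t : ℝ} (hac : a < c) (ht : 0 < t) (s : I) :
    ENNReal.ofReal (2 * (1 - (s : ℝ)) * t) *
      volume {x : ℝ | a < x ∧ x < c ∧ b * s < x * (1 - (s : ℝ))} =
    ENNReal.ofReal (t * (2 * max (c * (1 - (s : ℝ))) (b * s)
      - 2 * max (a * (1 - (s : ℝ))) (b * s))) := by
  rcases (sub_nonneg.2 s.2.2).eq_or_lt with h | h
  · simp [← h]
  set q := b * s / (1 - (s : ℝ)) with hq
  have hq' : b * s = q * (1 - (s : ℝ)) := by rw [hq]; field_simp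
  have hset : {x : ℝ | a < x ∧ x < c ∧ b * s < x * (1 - (s : ℝ))} = Ioo (max a q) c := by
    ext x
    simp only [mem_ofPred_eq, mem_Ioo, max_lt_iff, hq', mul_lt_mul_iff_left₀ h]
    tauto
  rw [hset, Real.volume_Ioo, ← ENNReal.ofReal_mul (by positivity), hq',
    ← max_mul_of_nonneg _ _ h.le, ← max_mul_of_nonneg _ _ h.le]
  rcases le_total q c with hqc | hqc
  · rw [max_eq_left hqc]
    ring_nf
  · rw [max_eq_right hqc, max_eq_right (hac.le.trans hqc), sub_self, mul_zero,
      ENNReal.ofReal_zero, ENNReal.ofReal_of_nonpos]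
    have : 0 ≤ 2 * (1 - (s : ℝ)) * t := by positivity
    exact mul_nonpos_of_nonneg_of_nonpos this (sub_nonpos.2 hqc)

lemma lintegral_radial_section (hϑ : ∫ x : I, (x : ℝ) ∂ϑ = 1 / 2) {a b t : ℝ}
    (hb : 0 ≤ b) (ht : 0 < t) :
    ∫⁻ s : I, ENNReal.ofReal (2 * (1 - (s : ℝ)) * t) *
      volume {x : ℝ | a < x ∧ t * tailDep ϑ x b < 1 ∧ b * s < x * (1 - (s : ℝ))} ∂ϑ =
    ENNReal.ofReal (max (1 - t * tailDep ϑ a b) 0) := by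
  rcases lt_or_ge (t * tailDep ϑ a b) 1 with h | h
  -- With `ℓ(c,b) = 1/t` the angular integral becomes `t(ℓ(c,b) - ℓ(a,b)) = 1 - tℓ(a,b)`.
  · obtain ⟨c, hc, hcx⟩ := Monotone.exists_threshold (f := fun x => tailDep ϑ x b)
      (fun x y hxy => tailDep_mono hxy le_rfl)
      (continuous_tailDep.comp (by fun_prop : Continuous fun y : ℝ => (y, b)))
      (a := a) (d := 1 / t) (r := 1 / t) (by rw [lt_div_iff₀ ht]; linarith)
      (le_tailDep_left hϑ (by positivity) hb)
    have hac : a < c := (hcx a).1 (by rw [lt_div_iff₀ ht]; linarith)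
    have hset : ∀ s : I, {x : ℝ | a < x ∧ t * tailDep ϑ x b < 1 ∧ b * s < x * (1 - (s : ℝ))} =
        {x : ℝ | a < x ∧ x < c ∧ b * s < x * (1 - (s : ℝ))} := by
      intro s
      ext x
      simp only [mem_ofPred_eq, ← hcx x, lt_div_iff₀ ht, mul_comm t]
    simp_rw [hset, volume_section_mul hac ht]
    rw [← ofReal_integral_eq_lintegral_ofReal (integrable_of_continuous (by fun_prop))
      (Eventually.of_forall fun s => ?_), integral_const_mul, integral_sub
      (integrable_of_continuous (by fun_prop)) (integrable_of_continuous (by fun_prop))]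
    · change ENNReal.ofReal (t * (tailDep ϑ c b - tailDep ϑ a b)) = _
      rw [hc, max_eq_left (by linarith), mul_sub, mul_one_div_cancel ht.ne']
    · have h1 := mul_le_mul_of_nonneg_right hac.le (sub_nonneg.2 s.2.2)
      have h2 := max_le_max_right (b * (s : ℝ)) h1
      exact mul_nonneg ht.le (by linarith)
  · rw [max_eq_right (by linarith), ENNReal.ofReal_zero]
    refine (lintegral_congr fun s => ?_).trans lintegral_zero
    have : {x : ℝ | a < x ∧ t * tailDep ϑ x b < 1 ∧ b * s < x * (1 - (s : ℝ))} = ∅ := by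
      ext x
      simp only [mem_ofPred_eq, mem_empty_iff_false, iff_false]
      rintro ⟨h1, h2, _⟩
      have := mul_le_mul_of_nonneg_left (tailDep_mono (ϑ := ϑ) h1.le (le_refl b)) ht.le
      linarith
    simp [this]

variable [IsProbabilityMeasure γ]

instance : SFinite (baseMeasure γ ϑ) := by unfold baseMeasure; infer_instance

/-- The survival function of the random vector. -/
lemma sampleMeasure_survival (h0 : γ {0} = 0) (hϑ : ∫ x : I, (x : ℝ) ∂ϑ = 1 / 2) {a b : ℝ}
    (ha : 0 ≤ a) (hb : 0 ≤ b) :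
    sampleMeasure γ ϑ {ω | a < ω.1 ∧ b < secondCoord ϑ ω} =
      ENNReal.ofReal (psi γ (tailDep ϑ a b)) := by
  have hE : MeasurableSet {ω : ℝ × ℝ≥0 × I | a < ω.1 ∧ b < secondCoord ϑ ω} :=
    (measurableSet_lt measurable_const measurable_fst).inter
      (measurableSet_lt measurable_const (measurable_secondCoord hϑ))
  set F : Set (ℝ × ℝ≥0 × I) := {ω | a < ω.1 ∧ (ω.2.1 : ℝ) * tailDep ϑ ω.1 b < 1 ∧
    b * ω.2.2 < ω.1 * (1 - (ω.2.2 : ℝ))} with hF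
  have m1 : MeasurableSet {ω : ℝ × ℝ≥0 × I | a < ω.1} := measurableSet_lt (by fun_prop) (by fun_prop)
  have hFm : MeasurableSet F := m1.inter (measurableSet_tailDep_lt b)
  -- The cut-off `a * t < 1` in the density is redundant here, being implied by `tℓ(a,b) < 1` and `a
  -- ≤ ℓ(a,b)`; for `t = 0` both sides vanish.
  have hind : ∀ ω : ℝ × ℝ≥0 × I,
      {ω : ℝ × ℝ≥0 × I | a < ω.1 ∧ b < secondCoord ϑ ω}.indicator sampleDensity ω =
      F.indicator (fun ω => ENNReal.ofReal (2 * (1 - (ω.2.2 : ℝ)) * ω.2.1)) ω := by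
    intro ω
    by_cases hω : 0 < ω.2.1
    · have hω' : 0 < (ω.2.1 : ℝ) := hω
      by_cases hωF : ω ∈ F
      · have ha0 : 0 < ω.1 := ha.trans_lt hωF.1
        rw [indicator_of_mem hωF, indicator_of_mem, sampleDensity, indicator_of_mem]
        · refine ⟨ha0, ?_⟩
          have := mul_le_mul_of_nonneg_left (le_tailDep_left (ϑ := ϑ) hϑ ha0.le hb) hω'.le
          have := hωF.2.1
          linarith
        · exact ⟨hωF.1, (lt_secondCoord hϑ hb).2 ⟨ha0, hω, hωF.2.1, hωF.2.2⟩⟩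
      · rw [indicator_of_notMem hωF, indicator_of_notMem]
        rintro ⟨h1, h2⟩
        rw [lt_secondCoord hϑ hb] at h2
        exact hωF ⟨h1, h2.2.2⟩
    · have h00 : ω.2.1 = 0 := le_antisymm (not_lt.1 hω) zero_le
      rw [indicator_of_notMem]
      · simp [indicator, h00]
      · rintro ⟨h1, h2⟩
        rw [lt_secondCoord hϑ hb] at h2
        exact hω h2.2.1
  have hmF : Measurable (F.indicator fun ω : ℝ × ℝ≥0 × I =>
      ENNReal.ofReal (2 * (1 - (ω.2.2 : ℝ)) * ω.2.1)) :=
    Measurable.indicator (by fun_prop) hFm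
  rw [sampleMeasure, withDensity_apply _ hE, ← lintegral_indicator hE, lintegral_congr hind,
    baseMeasure, lintegral_prod_symm' _ hmF,
    lintegral_prod _ (hmF.lintegral_prod_left').aemeasurable]
  have hsec : ∀ (t : ℝ≥0) (s : I), ∫⁻ x : ℝ, F.indicator (fun ω : ℝ × ℝ≥0 × I =>
      ENNReal.ofReal (2 * (1 - (ω.2.2 : ℝ)) * ω.2.1)) (x, t, s) =
      ENNReal.ofReal (2 * (1 - (s : ℝ)) * t) * volume {x : ℝ | a < x ∧
        (t : ℝ) * tailDep ϑ x b < 1 ∧ b * s < x * (1 - (s : ℝ))} := by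
    intro t s
    have hms : MeasurableSet {x : ℝ | a < x ∧
        (t : ℝ) * tailDep ϑ x b < 1 ∧ b * s < x * (1 - (s : ℝ))} :=
      (measurable_id.prodMk measurable_const : Measurable fun x : ℝ => (x, (t, s))) hFm
    rw [← lintegral_indicator_const hms]
    rfl
  simp_rw [hsec]
  have hnn : 0 ≤ tailDep ϑ a b := ha.trans (le_tailDep_left hϑ ha hb)
  rw [psi_of_nonneg hnn, ofReal_integral_eq_lintegral_ofReal (integrable_psi hnn)
    (Eventually.of_forall fun t => le_max_right _ _)]
  refine lintegral_congr_ae ?_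
  filter_upwards [ae_pos h0] with t ht
  exact lintegral_radial_section hϑ hb ht

omit [IsProbabilityMeasure γ] in
lemma ae_secondCoord_pos (hϑ : ∫ x : I, (x : ℝ) ∂ϑ = 1 / 2) :
    ∀ᵐ ω ∂sampleMeasure γ ϑ, 0 < secondCoord ϑ ω := by
  filter_upwards [ae_sampleMeasure (γ := γ) (ϑ := ϑ)] with ω hω
  rw [lt_secondCoord hϑ le_rfl, tailDep_zero_right hϑ hω.1.le]
  refine ⟨hω.1, hω.2.2.1, by rw [mul_comm]; exact hω.2.1, ?_⟩
  rw [zero_mul]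
  exact mul_pos hω.1 (sub_pos.2 hω.2.2.2)

lemma isProbabilityMeasure_sampleMeasure (h0 : γ {0} = 0) (hϑ : ∫ x : I, (x : ℝ) ∂ϑ = 1 / 2) :
    IsProbabilityMeasure (sampleMeasure γ ϑ) := by
  constructor
  have h1 := sampleMeasure_survival h0 hϑ (γ := γ) (ϑ := ϑ) le_rfl le_rfl
  rw [tailDep_zero_right hϑ le_rfl, psi_zero, ENNReal.ofReal_one] at h1
  rw [← h1, eq_comm]
  refine measure_eq_measure_of_null_sdiff (subset_univ _) ?_
  refine measure_mono_null (fun ω hω => ?_) (mem_ae_iff.1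
    ((ae_sampleMeasure (γ := γ) (ϑ := ϑ)).and (ae_secondCoord_pos (γ := γ) hϑ)))
  exact fun h => hω.2 ⟨h.1.1, h.2⟩

end Sampling

/-! ### A copula is determined by its distribution function. -/

lemma Iio_zero_unitInterval : Iio (0 : I) = ∅ :=
  eq_empty_of_forall_notMem fun _ hw => absurd unitInterval.nonneg' (not_le.2 hw)

lemma Iic_one_unitInterval : Iic (1 : I) = univ :=
  eq_univ_of_forall fun _ => unitInterval.le_one'

lemma ext_of_Iio_unitInterval {μ ν : Measure I} [IsFiniteMeasure μ] (huniv : μ univ = ν univ)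
    (h : ∀ x : I, 0 < x → μ (Iio x) = ν (Iio x)) : μ = ν := by
  refine ext_of_generate_finite (range Iio)
    ((BorelSpace.measurable_eq (α := I)).trans (borel_eq_generateFrom_Iio I)) isPiSystem_Iio ?_ huniv
  rintro _ ⟨x, rfl⟩
  rcases (unitInterval.nonneg' (t := x)).eq_or_lt with h0 | h0
  · rw [← h0, Iio_zero_unitInterval, measure_empty, measure_empty]
  · exact h x h0

namespace Copula

lemma measure_fst_preimage (C : Copula) {s : Set I} (hs : MeasurableSet s) :
    C.measure (Prod.fst ⁻¹' s) = volume s := by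
  rw [← C.map_fst, Measure.map_apply measurable_fst hs]

lemma measure_snd_preimage (C : Copula) {s : Set I} (hs : MeasurableSet s) :
    C.measure (Prod.snd ⁻¹' s) = volume s := by
  rw [← C.map_snd, Measure.map_apply measurable_snd hs]

/-- Horizontal and vertical lines are null because the marginals are uniform. Open rectangles are
the form in which survival events appear. -/
lemma measure_Iic_prod_Iic (C : Copula) (x y : I) :
    C.measure (Iic x ×ˢ Iic y) = C.measure (Iio x ×ˢ Iio y) := by
  refine (measure_eq_measure_of_null_sdiff (Set.prod_mono Iio_subset_Iic_self Iio_subset_Iic_self)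
    ?_).symm
  refine measure_mono_null (t := Prod.fst ⁻¹' {x} ∪ Prod.snd ⁻¹' {y}) ?_
    (measure_union_null ?_ ?_)
  · rintro ⟨u, v⟩ ⟨⟨hu, hv⟩, h⟩
    by_contra hcon
    simp only [mem_union, mem_preimage, mem_singleton_iff, not_or] at hcon
    exact h ⟨lt_of_le_of_ne hu hcon.1, lt_of_le_of_ne hv hcon.2⟩
  · rw [C.measure_fst_preimage (measurableSet_singleton x), measure_singleton]
  · rw [C.measure_snd_preimage (measurableSet_singleton y), measure_singleton]

lemma cdf_eq (C : Copula) (x y : I) : C.cdf x y = C.measure.real (Iio x ×ˢ Iio y) := by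
  have h : ∀ z : I, Icc 0 z = Iic z := fun z => by
    ext w
    simp
  rw [cdf, h, h, measureReal_def, C.measure_Iic_prod_Iic, measureReal_def]

lemma ext_of_cdf {C D : Copula} (h : ∀ x ∈ Ioo (0 : I) 1, ∀ y ∈ Ioo (0 : I) 1,
    C.cdf x y = D.cdf x y) : C = D := by
  have hgen : (inferInstance : MeasurableSpace (I × I)) =
      MeasurableSpace.generateFrom (image2 (· ×ˢ ·) (range (Iic : I → Set I)) (range Iic)) := by
    have hs : IsCountablySpanning (range (Iic : I → Set I)) :=
      ⟨fun _ => univ, fun _ => ⟨1, Iic_one_unitInterval⟩, iUnion_const _⟩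
    have hI : (inferInstance : MeasurableSpace I) =
        MeasurableSpace.generateFrom (range (Iic : I → Set I)) :=
      (BorelSpace.measurable_eq (α := I)).trans (borel_eq_generateFrom_Iic I)
    rw [← generateFrom_prod_eq hs hs, ← hI]
  refine Copula.ext (ext_of_generate_finite _ hgen (isPiSystem_Iic.prod isPiSystem_Iic) ?_ (by simp))
  rintro _ ⟨_, ⟨x, rfl⟩, _, ⟨y, rfl⟩, rfl⟩
  simp only
  -- On the boundary of the square the values are forced by the marginals.
  have bdry : ∀ E : Copula, (x = 1 → E.measure (Iic x ×ˢ Iic y) = volume (Iic y)) ∧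
      (y = 1 → E.measure (Iic x ×ˢ Iic y) = volume (Iic x)) ∧
      (x = 0 → E.measure (Iic x ×ˢ Iic y) = 0) ∧ (y = 0 → E.measure (Iic x ×ˢ Iic y) = 0) := by
    intro E
    have h1 := Iic_one_unitInterval
    have h2 := Iio_zero_unitInterval
    refine ⟨?_, ?_, ?_, ?_⟩
    · rintro rfl
      rw [h1, univ_prod, E.measure_snd_preimage measurableSet_Iic]
    · rintro rfl
      rw [h1, prod_univ, E.measure_fst_preimage measurableSet_Iic]
    · rintro rfl
      rw [E.measure_Iic_prod_Iic, h2, empty_prod, measure_empty]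
    · rintro rfl
      rw [E.measure_Iic_prod_Iic, h2, prod_empty, measure_empty]
  obtain ⟨c1, c2, c3, c4⟩ := bdry C
  obtain ⟨d1, d2, d3, d4⟩ := bdry D
  by_cases hx1 : x = 1
  · rw [c1 hx1, d1 hx1]
  by_cases hy1 : y = 1
  · rw [c2 hy1, d2 hy1]
  by_cases hx0 : x = 0
  · rw [c3 hx0, d3 hx0]
  by_cases hy0 : y = 0
  · rw [c4 hy0, d4 hy0]
  have := h x ⟨unitInterval.pos_iff_ne_zero.2 hx0, unitInterval.lt_one_iff_ne_one.2 hx1⟩ y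
    ⟨unitInterval.pos_iff_ne_zero.2 hy0, unitInterval.lt_one_iff_ne_one.2 hy1⟩
  rw [cdf_eq, cdf_eq, measureReal_eq_measureReal_iff] at this
  rw [measure_Iic_prod_Iic, measure_Iic_prod_Iic, this]

end Copula

lemma IsArchimaxCopula.unique {γ : Measure ℝ≥0} {ϑ : Measure I} {C D : Copula}
    (hC : IsArchimaxCopula γ ϑ C) (hD : IsArchimaxCopula γ ϑ D) : C = D :=
  Copula.ext_of_cdf fun x hx y hy =>
    (hC x hx y hy).trans (hD x hx y hy).symm

/-! ### Existence of the Archimax copula. -/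

section Archimax

variable {γ : Measure ℝ≥0} {ϑ : Measure I} [IsProbabilityMeasure γ] [IsProbabilityMeasure ϑ]

/-- The generator with values in the unit interval. -/
noncomputable def psiI (γ : Measure ℝ≥0) [IsProbabilityMeasure γ] (z : ℝ) : I :=
  ⟨psi γ z, psi_nonneg z, psi_le_one z⟩

lemma continuous_psiI : Continuous (psiI γ) := continuous_psi.subtype_mk _

lemma exists_psiI_lt_iff (h0 : γ {0} = 0) {x : I} (hx : 0 < x) :
    ∃ z, 0 ≤ z ∧ psi γ z = x ∧ ∀ w, psiI γ w < x ↔ z < w := by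
  obtain ⟨z, hz, hzx⟩ := exists_psi_eq h0 (show 0 < (x : ℝ) from hx) x.2.2
  refine ⟨z, hz, hzx, fun w => ?_⟩
  rw [← psi_lt_psi_iff h0 hz (by rw [hzx]; exact hx), hzx]
  rfl

/-- The point of the unit square determined by a sample point. -/
noncomputable def samplePair (γ : Measure ℝ≥0) [IsProbabilityMeasure γ] (ϑ : Measure I)
    (ω : ℝ × ℝ≥0 × I) : I × I :=
  (psiI γ ω.1, psiI γ (secondCoord ϑ ω))

lemma measurable_samplePair (hϑ : ∫ x : I, (x : ℝ) ∂ϑ = 1 / 2) :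
    Measurable (samplePair γ ϑ) :=
  (continuous_psiI.measurable.comp measurable_fst).prodMk
    (continuous_psiI.measurable.comp (measurable_secondCoord hϑ))

/-- The Archimax copula of a Williamson measure and a Pickands dependence measure. -/
noncomputable def archimaxCopula (γ : Measure ℝ≥0) (ϑ : Measure I) [IsProbabilityMeasure γ]
    [IsProbabilityMeasure ϑ] (h0 : γ {0} = 0) (hϑ : ∫ x : I, (x : ℝ) ∂ϑ = 1 / 2) : Copula where
  measure := (sampleMeasure γ ϑ).map (samplePair γ ϑ)
  map_fst := by
    have := isProbabilityMeasure_sampleMeasure h0 hϑ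
    have hm := measurable_samplePair (γ := γ) hϑ
    rw [Measure.map_map measurable_fst hm]
    have hm' : Measurable (Prod.fst ∘ samplePair γ ϑ) := measurable_fst.comp hm
    have := Measure.isProbabilityMeasure_map (μ := sampleMeasure γ ϑ) hm'.aemeasurable
    refine ext_of_Iio_unitInterval (by simp) fun x hx => ?_
    obtain ⟨z, hz, hzx, hiff⟩ := exists_psiI_lt_iff h0 hx
    -- The survival function at `(z, 0)` is `ψ(ℓ(z,0)) = ψ(z) = x`, the uniform distribution
    -- function.
    have hs := sampleMeasure_survival h0 hϑ hz le_rfl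
    rw [tailDep_zero_right hϑ hz, hzx] at hs
    rw [Measure.map_apply hm' measurableSet_Iio, unitInterval.volume_Iio, ← hs, eq_comm]
    refine measure_eq_measure_of_null_sdiff (fun ω hω => (hiff _).2 hω.1) ?_
    refine measure_mono_null (fun ω hω => ?_) (mem_ae_iff.1 (ae_secondCoord_pos (γ := γ) hϑ))
    exact fun h => hω.2 ⟨(hiff _).1 hω.1, h⟩
  map_snd := by
    have := isProbabilityMeasure_sampleMeasure h0 hϑ
    have hm := measurable_samplePair (γ := γ) hϑ
    rw [Measure.map_map measurable_snd hm]
    have hm' : Measurable (Prod.snd ∘ samplePair γ ϑ) := measurable_snd.comp hm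
    have := Measure.isProbabilityMeasure_map (μ := sampleMeasure γ ϑ) hm'.aemeasurable
    refine ext_of_Iio_unitInterval (by simp) fun x hx => ?_
    obtain ⟨z, hz, hzx, hiff⟩ := exists_psiI_lt_iff h0 hx
    have hs := sampleMeasure_survival h0 hϑ le_rfl hz
    rw [tailDep_zero_left hϑ hz, hzx] at hs
    rw [Measure.map_apply hm' measurableSet_Iio, unitInterval.volume_Iio, ← hs, eq_comm]
    refine measure_eq_measure_of_null_sdiff (fun ω hω => (hiff _).2 hω.2) ?_
    refine measure_mono_null (fun ω hω => ?_) (mem_ae_iff.1 (ae_sampleMeasure (γ := γ) (ϑ := ϑ)))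
    exact fun h => hω.2 ⟨h.1, (hiff _).1 hω.1⟩

lemma isArchimaxCopula_archimaxCopula (h0 : γ {0} = 0) (hϑ : ∫ x : I, (x : ℝ) ∂ϑ = 1 / 2) :
    IsArchimaxCopula γ ϑ (archimaxCopula γ ϑ h0 hϑ) := by
  intro x hx y hy
  obtain ⟨z, hz, hzx, hziff⟩ := exists_psiI_lt_iff h0 hx.1
  obtain ⟨w, hw, hwy, hwiff⟩ := exists_psiI_lt_iff h0 hy.1
  have hne : ∀ {x : I} {z : ℝ}, x < 1 → 0 ≤ z → psi γ z = x → 0 < z := by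
    intro x z hx hz h
    refine hz.lt_of_ne ?_
    rintro rfl
    rw [psi_zero] at h
    have : (x : ℝ) < 1 := hx
    linarith
  simp only
  rw [toReal_pseudoInverse h0 hz hx.1 hzx, toReal_pseudoInverse h0 hw hy.1 hwy,
    mul_pickandsFunction hϑ (hne hx.2 hz hzx) (hne hy.2 hw hwy), Copula.cdf_eq, measureReal_def]
  have hset : samplePair γ ϑ ⁻¹' (Iio x ×ˢ Iio y) = {ω | z < ω.1 ∧ w < secondCoord ϑ ω} := by
    ext ω
    exact and_congr (hziff _) (hwiff _)
  rw [archimaxCopula, Measure.map_apply (measurable_samplePair hϑ)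
    (measurableSet_Iio.prod measurableSet_Iio), hset, sampleMeasure_survival h0 hϑ hz hw,
    ENNReal.toReal_ofReal (psi_nonneg _), psi]

end Archimax

/-- If the increments of `g` are locally controlled by those of `f`, then `g` maps the preimages
under `f` of null sets to null sets. -/
lemma volume_image_preimage_eq_zero {f g : ℝ → ℝ} {D : ℕ → Set ℝ} {K : ℕ → ℝ≥0}
    (h : ∀ n, ∀ b ∈ D n, ∀ b' ∈ D n, |g b - g b'| ≤ K n * |f b - f b'|) {M : Set ℝ}
    (hM : volume M = 0) : volume (g '' {b | (∃ n, b ∈ D n) ∧ f b ∈ M}) = 0 := by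
  have hsub : g '' {b | (∃ n, b ∈ D n) ∧ f b ∈ M} ⊆ ⋃ n, g '' (D n ∩ f ⁻¹' M) := by
    rintro _ ⟨b, ⟨⟨n, hn⟩, hb⟩, rfl⟩
    exact mem_iUnion.2 ⟨n, b, ⟨hn, hb⟩, rfl⟩
  refine measure_mono_null hsub (measure_iUnion_null fun n => ?_)
  set S := D n ∩ f ⁻¹' M with hS
  -- On one piece `g` factors through `f` via a Lipschitz map, obtained from any right inverse of
  -- `f`. Hausdorff measure then bounds the image without requiring measurability.
  have hinv : ∀ y ∈ f '' S, Function.invFunOn f S y ∈ S ∧ f (Function.invFunOn f S y) = y :=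
    fun y hy => ⟨Function.invFunOn_mem hy, Function.invFunOn_eq hy⟩
  have hlip : LipschitzOnWith (K n) (g ∘ Function.invFunOn f S) (f '' S) := by
    refine LipschitzOnWith.of_dist_le_mul fun y hy y' hy' => ?_
    have := h n _ (hinv y hy).1.1 _ (hinv y' hy').1.1
    rwa [(hinv y hy).2, (hinv y' hy').2] at this
  have himg : g '' S ⊆ (g ∘ Function.invFunOn f S) '' (f '' S) := by
    rintro _ ⟨b, hb, rfl⟩
    have hfb : f b ∈ f '' S := ⟨b, hb, rfl⟩
    refine ⟨f b, hfb, ?_⟩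
    have := h n _ (hinv _ hfb).1.1 _ hb.1
    rw [(hinv _ hfb).2, sub_self, abs_zero, mul_zero] at this
    exact sub_eq_zero.1 (abs_eq_zero.1 (le_antisymm this (abs_nonneg _)))
  have h1 := hlip.hausdorffMeasure_image_le zero_le_one
  rw [hausdorffMeasure_real] at h1
  have h2 : volume (f '' S) = 0 := measure_mono_null (by rintro _ ⟨b, hb, rfl⟩; exact hb.2) hM
  rw [h2, mul_zero] at h1
  exact measure_mono_null himg (le_zero_iff.1 h1)

/-! ### Transfer of null and countable sets between radii and conditional values. -/

section Transfer

variable {γ : Measure ℝ≥0} {ϑ : Measure I}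

/-- The second coordinates for which the generator, and the tail dependence function at the
first coordinate `a`, are locally bi-Lipschitz. -/
def regularSet (γ : Measure ℝ≥0) (ϑ : Measure I) (a : ℝ) : Set ℝ :=
  {b | 0 < b ∧ 0 < psi γ b ∧ a < tailDep ϑ a b}

/-- Countably many such sets cover `regularSet` when `a ≥ 0`; on each, all Lipschitz constants are
uniform in `b`. -/
def regularPiece (γ : Measure ℝ≥0) (ϑ : Measure I) (a : ℝ) (n : ℕ) : Set ℝ :=
  {b | 1 / ((n : ℝ) + 1) ≤ b ∧ b ≤ n + 1 ∧ 1 / ((n : ℝ) + 1) ≤ psiSlope γ b ∧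
    1 / ((n : ℝ) + 1) ≤ tailSlope ϑ a b}

variable [IsProbabilityMeasure γ] [IsProbabilityMeasure ϑ]

lemma exists_mem_regularPiece (h0 : γ {0} = 0) (hϑ : ∫ x : I, (x : ℝ) ∂ϑ = 1 / 2) {a b : ℝ}
    (ha : 0 ≤ a) (hb : b ∈ regularSet γ ϑ a) : ∃ n, b ∈ regularPiece γ ϑ a n := by
  obtain ⟨hb0, hb1, hb2⟩ := hb
  have h1 := psiSlope_pos h0 hb0 hb1
  have h2 := tailSlope_pos ha (measure_pos_of_lt_tailDep hϑ hb2)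
  have key : ∀ {x : ℝ}, 0 < x → ∀ᶠ n : ℕ in atTop, 1 / ((n : ℝ) + 1) ≤ x := fun hx =>
    (tendsto_one_div_add_atTop_nhds_zero_nat.eventually_lt_const hx).mono fun _ h => h.le
  have h3 : ∀ᶠ n : ℕ in atTop, b ≤ n + 1 :=
    (tendsto_natCast_atTop_atTop.eventually_ge_atTop b).mono fun n hn => by linarith
  exact ((key hb0).and (h3.and ((key h1).and (key h2)))).exists

lemma abs_sub_le_mul_abs_psi_sub {b b' N : ℝ} (hN : 0 < N) (hb0 : 0 ≤ b) (hb0' : 0 ≤ b')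
    (hb : 1 / N ≤ psiSlope γ b) (hb' : 1 / N ≤ psiSlope γ b') :
    |b - b'| ≤ N * |psi γ b - psi γ b'| := by
  wlog hlt : b < b' generalizing b b'
  · rcases (not_lt.1 hlt).eq_or_lt with h | h
    · simp [h]
    · rw [abs_sub_comm, abs_sub_comm (psi γ b)]
      exact this hb0' hb0 hb' hb h
  have h1 := psi_sub_psi_ge (γ := γ) hb0 hlt
  have h2 := (mul_le_mul_of_nonneg_left hb' (sub_pos.2 hlt).le).trans h1
  rw [abs_sub_comm, abs_of_pos (sub_pos.2 hlt)]
  rw [mul_one_div, div_le_iff₀ hN] at h2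
  have := mul_le_mul_of_nonneg_left (le_abs_self (psi γ b - psi γ b')) hN.le
  linarith

omit [IsProbabilityMeasure γ] in
lemma abs_tailDep_sub_le (hϑ : ∫ x : I, (x : ℝ) ∂ϑ = 1 / 2) (a b b' : ℝ) :
    |tailDep ϑ a b - tailDep ϑ a b'| ≤ |b - b'| := by
  wlog hlt : b' ≤ b generalizing b b'
  · rw [abs_sub_comm, abs_sub_comm b]
    exact this _ _ (le_of_not_ge hlt)
  rw [abs_of_nonneg (sub_nonneg.2 hlt), abs_of_nonneg (sub_nonneg.2 (tailDep_mono le_rfl hlt))]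
  exact tailDep_sub_le hϑ hlt

omit [IsProbabilityMeasure γ] in
lemma abs_sub_le_mul_abs_tailDep_sub {a b b' N : ℝ} (hN : 0 < N)
    (hb : 1 / N ≤ tailSlope ϑ a b) (hb' : 1 / N ≤ tailSlope ϑ a b') :
    |b - b'| ≤ N * |tailDep ϑ a b - tailDep ϑ a b'| := by
  wlog hlt : b ≤ b' generalizing b b'
  · rw [abs_sub_comm, abs_sub_comm (tailDep ϑ a b)]
    exact this hb' hb (le_of_not_ge hlt)
  have h1 := tailDep_sub_ge (ϑ := ϑ) (a := a) hlt
  have h2 := (mul_le_mul_of_nonneg_left hb (sub_nonneg.2 hlt)).trans h1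
  rw [abs_sub_comm, abs_of_nonneg (sub_nonneg.2 hlt), abs_sub_comm]
  rw [mul_one_div, div_le_iff₀ hN] at h2
  have := mul_le_mul_of_nonneg_left (le_abs_self (tailDep ϑ a b' - tailDep ϑ a b)) hN.le
  linarith

/-- Increments of `ψ` and of `ℓ(a,·)` are both comparable with `|b - b'|`. Passing to `1/ℓ` costs
the factor `ℓ(a,b) ℓ(a,b')`, controlled by `1/N ≤ ℓ ≤ a + N` with `N = n + 1`. -/
lemma regularPiece_estimates (hϑ : ∫ x : I, (x : ℝ) ∂ϑ = 1 / 2) {a : ℝ} (ha : 0 ≤ a) {n : ℕ}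
    {b b' : ℝ} (hb : b ∈ regularPiece γ ϑ a n) (hb' : b' ∈ regularPiece γ ϑ a n) :
    |1 / tailDep ϑ a b - 1 / tailDep ϑ a b'| ≤
      ((n : ℝ) + 1) ^ 2 * ((n : ℝ) + 1) * |psi γ b - psi γ b'| ∧
    |psi γ b - psi γ b'| ≤ ((n : ℝ) + 1) * ((n : ℝ) + 1) * (a + ((n : ℝ) + 1)) ^ 2 *
      |1 / tailDep ϑ a b - 1 / tailDep ϑ a b'| := by
  set N : ℝ := (n : ℝ) + 1 with hN
  have hN0 : 0 < N := by positivity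
  have hN1 : 0 < 1 / N := by positivity
  obtain ⟨u1, u2, u3, u4⟩ := hb
  obtain ⟨v1, v2, v3, v4⟩ := hb'
  have hb0 : 0 ≤ b := hN1.le.trans u1
  have hb0' : 0 ≤ b' := hN1.le.trans v1
  have bound : ∀ {x : ℝ}, 1 / N ≤ x → x ≤ N → 1 / N ≤ tailDep ϑ a x ∧ tailDep ϑ a x ≤ a + N := by
    intro x h1 h2
    have hx0 : 0 ≤ x := hN1.le.trans h1
    have h3 := tailDep_sub_le (a := a) hϑ hx0
    rw [tailDep_zero_right hϑ ha] at h3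
    exact ⟨h1.trans (le_tailDep_right hϑ ha hx0), by linarith⟩
  obtain ⟨p1, p2⟩ := bound u1 u2
  obtain ⟨q1, q2⟩ := bound v1 v2
  set l := tailDep ϑ a b
  set l' := tailDep ϑ a b'
  have hl : 0 < l := hN1.trans_le p1
  have hl' : 0 < l' := hN1.trans_le q1
  have hll : |1 / l - 1 / l'| * (l * l') = |l - l'| := by
    rw [← abs_of_pos (mul_pos hl hl'), ← abs_mul, abs_sub_comm l]
    congr 1
    field_simp
  have e1 : |psi γ b - psi γ b'| ≤ N * |b - b'| := by
    have := abs_psi_sub_le (γ := γ) hN1 u1 v1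
    rwa [div_div_eq_mul_div, div_one, mul_comm] at this
  have e2 := abs_sub_le_mul_abs_psi_sub hN0 hb0 hb0' u3 v3
  have e3 : |l - l'| ≤ |b - b'| := abs_tailDep_sub_le hϑ a b b'
  have e4 : |b - b'| ≤ N * |l - l'| := abs_sub_le_mul_abs_tailDep_sub hN0 u4 v4
  constructor
  · have h1 : 1 ≤ N ^ 2 * (l * l') := by
      have h2 : 1 / N * (1 / N) ≤ l * l' := mul_le_mul p1 q1 hN1.le hl.le
      calc (1 : ℝ) = N ^ 2 * (1 / N * (1 / N)) := by field_simp
        _ ≤ _ := mul_le_mul_of_nonneg_left h2 (by positivity)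
    calc |1 / l - 1 / l'| ≤ |1 / l - 1 / l'| * (N ^ 2 * (l * l')) :=
          le_mul_of_one_le_right (abs_nonneg _) h1
      _ = N ^ 2 * |l - l'| := by rw [← hll]; ring
      _ ≤ N ^ 2 * (N * |psi γ b - psi γ b'|) :=
          mul_le_mul_of_nonneg_left (e3.trans e2) (by positivity)
      _ = _ := by ring
  · have h1 : l * l' ≤ (a + N) ^ 2 := by
      rw [sq]
      exact mul_le_mul p2 q2 hl'.le (by positivity)
    calc |psi γ b - psi γ b'| ≤ N * (N * |l - l'|) :=
          e1.trans (mul_le_mul_of_nonneg_left e4 hN0.le)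
      _ = N * N * (|1 / l - 1 / l'| * (l * l')) := by rw [hll]; ring
      _ ≤ N * N * (|1 / l - 1 / l'| * (a + N) ^ 2) := by gcongr
      _ = _ := by ring

lemma lebesgue_apply (T : Set ℝ≥0) : lebesgue T = volume ((fun t : ℝ≥0 => (t : ℝ)) '' T) :=
  (MeasurableEmbedding.subtype_coe (measurableSet_Ici (a := (0 : ℝ)))).comap_apply volume T

/-- The radial variables `t` and the points `y` of the unit interval that are
related through a regular second coordinate `b`, with `y = ψ(b)` and `t * tailDep a b = 1`. -/
def radialRel (γ : Measure ℝ≥0) [IsProbabilityMeasure γ] (ϑ : Measure I) (a : ℝ) (t : ℝ≥0)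
    (y : I) : Prop :=
  ∃ b ∈ regularSet γ ϑ a, psiI γ b = y ∧ (t : ℝ) * tailDep ϑ a b = 1

lemma lebesgue_radialRel (h0 : γ {0} = 0) (hϑ : ∫ x : I, (x : ℝ) ∂ϑ = 1 / 2) {a : ℝ}
    (ha : 0 ≤ a) {M : Set I} (hM : volume M = 0) :
    lebesgue {t | ∃ y ∈ M, radialRel γ ϑ a t y} = 0 := by
  rw [unitInterval.volume_apply] at hM
  rw [lebesgue_apply]
  refine measure_mono_null ?_ (volume_image_preimage_eq_zero (f := psi γ)
    (g := fun b => 1 / tailDep ϑ a b) (D := regularPiece γ ϑ a)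
    (K := fun n => ((n : ℝ≥0) + 1) ^ 2 * ((n : ℝ≥0) + 1))
    (fun n b hb b' hb' => by simpa using (regularPiece_estimates hϑ ha hb hb').1) hM)
  rintro _ ⟨t, ⟨y, hy, b, hb, hby, htb⟩, rfl⟩
  exact ⟨b, ⟨exists_mem_regularPiece h0 hϑ ha hb, y, hy, by rw [← hby]; rfl⟩,
    (eq_one_div_of_mul_eq_one_left htb).symm⟩

lemma volume_radialRel (h0 : γ {0} = 0) (hϑ : ∫ x : I, (x : ℝ) ∂ϑ = 1 / 2) {a : ℝ}
    (ha : 0 ≤ a) {T : Set ℝ≥0} (hT : lebesgue T = 0) :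
    volume {y | ∃ t ∈ T, radialRel γ ϑ a t y} = 0 := by
  rw [lebesgue_apply] at hT
  rw [unitInterval.volume_apply]
  refine measure_mono_null ?_ (volume_image_preimage_eq_zero (f := fun b => 1 / tailDep ϑ a b)
    (g := psi γ) (D := regularPiece γ ϑ a)
    (K := fun n => ((n : ℝ≥0) + 1) * ((n : ℝ≥0) + 1) * (a.toNNReal + ((n : ℝ≥0) + 1)) ^ 2)
    (fun n b hb b' hb' => by simpa [ha] using (regularPiece_estimates hϑ ha hb hb').2) hT)
  rintro _ ⟨y, ⟨t, ht, b, hb, hby, htb⟩, rfl⟩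
  exact ⟨b, ⟨exists_mem_regularPiece h0 hϑ ha hb, t, ht, eq_one_div_of_mul_eq_one_left htb⟩,
    by rw [← hby]; rfl⟩

omit [IsProbabilityMeasure ϑ] in
-- Each `y` admits one `t` at most: `ψ` is injective where positive, so `y` fixes `b`, and `b` fixes
-- `t`.
lemma countable_radialRel_left (h0 : γ {0} = 0) {a : ℝ} {M : Set I} (hM : M.Countable) :
    {t | ∃ y ∈ M, radialRel γ ϑ a t y}.Countable := by
  have : {t | ∃ y ∈ M, radialRel γ ϑ a t y} = ⋃ y ∈ M, {t | radialRel γ ϑ a t y} := by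
    ext t; simp
  rw [this]
  refine hM.biUnion fun y _ => Set.Subsingleton.countable ?_
  rintro t ⟨b, hb, hby, htb⟩ t' ⟨b', hb', hby', htb'⟩
  have hbb : b = b' := psi_injOn h0 hb.1.le hb'.1.le hb.2.1
    (congrArg Subtype.val (hby.trans hby'.symm))
  subst hbb
  exact NNReal.coe_injective ((eq_one_div_of_mul_eq_one_left htb).trans
    (eq_one_div_of_mul_eq_one_left htb').symm)

/-- Each `t` admits one `y` at most, since `ℓ(a,·)` increases strictly once it exceeds `a`. -/
lemma countable_radialRel_right (hϑ : ∫ x : I, (x : ℝ) ∂ϑ = 1 / 2) {a : ℝ} (ha : 0 ≤ a)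
    {T : Set ℝ≥0} (hT : T.Countable) : {y | ∃ t ∈ T, radialRel γ ϑ a t y}.Countable := by
  have : {y | ∃ t ∈ T, radialRel γ ϑ a t y} = ⋃ t ∈ T, {y | radialRel γ ϑ a t y} := by
    ext t; simp
  rw [this]
  refine hT.biUnion fun t _ => Set.Subsingleton.countable ?_
  have key : ∀ {b b' : ℝ}, a < tailDep ϑ a b → b < b' → tailDep ϑ a b < tailDep ϑ a b' := by
    intro b b' h hbb
    have h1 := tailDep_sub_ge (ϑ := ϑ) (a := a) hbb.le
    have h2 := tailSlope_pos ha (measure_pos_of_lt_tailDep hϑ h)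
    have := mul_pos (sub_pos.2 hbb) h2
    linarith
  rintro y ⟨b, hb, hby, htb⟩ y' ⟨b', hb', hby', htb'⟩
  have hl : tailDep ϑ a b = tailDep ϑ a b' :=
    (eq_one_div_of_mul_eq_one_right htb).trans (eq_one_div_of_mul_eq_one_right htb').symm
  have hbb : b = b' := by
    rcases lt_trichotomy b b' with h | h | h
    · exact absurd hl (key hb.2.2 h).ne
    · exact h
    · exact absurd hl (key hb'.2.2 h).ne'
  rw [← hby, ← hby', hbb]

end Transfer

/-! ### The end points of the angular measure. -/

section Ends

variable {ϑ : Measure I}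

lemma lowerEnd_nonneg : 0 ≤ lowerEnd ϑ :=
  Real.sSup_nonneg (by rintro _ ⟨x, _, rfl⟩; exact x.2.1)

lemma measure_Icc_pos_of_lowerEnd_lt {x : I} (hx : lowerEnd ϑ < x) : 0 < ϑ (Icc 0 x) := by
  refine pos_iff_ne_zero.2 fun h => not_le.2 hx ?_
  exact le_csSup ⟨1, by rintro _ ⟨y, _, rfl⟩; exact y.2.2⟩ ⟨x, h, rfl⟩

lemma ae_lowerEnd_le : ∀ᵐ s : I ∂ϑ, lowerEnd ϑ ≤ s := by
  rw [ae_iff]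
  refine measure_null_of_locally_null _ fun s hs => ?_
  have hs' : (s : ℝ) < lowerEnd ϑ := not_le.1 hs
  have hne : ((fun x : I => (x : ℝ)) '' {x : I | ϑ (Icc 0 x) = 0}).Nonempty := by
    by_contra h
    rw [lowerEnd, not_nonempty_iff_eq_empty.1 h, Real.sSup_empty] at hs'
    exact absurd s.2.1 (not_le.2 hs')
  obtain ⟨_, ⟨x, hx, rfl⟩, hsx⟩ := exists_lt_of_lt_csSup hne hs'
  exact ⟨Icc 0 x, mem_nhdsWithin_of_mem_nhds (mem_of_superset (Iio_mem_nhds hsx)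
    fun y hy => ⟨unitInterval.nonneg', le_of_lt hy⟩), hx⟩

variable [IsProbabilityMeasure ϑ]

lemma Icc_zero_compl (x : I) : (Icc 0 x)ᶜ = Ioi x := by
  ext y
  simp

lemma one_mem_upperEnd :
    (1 : ℝ) ∈ (fun x : I => (x : ℝ)) '' {x : I | ϑ (Icc 0 x) = 1} := by
  refine ⟨1, ?_, rfl⟩
  have : Icc (0 : I) 1 = univ := eq_univ_of_forall fun y => ⟨unitInterval.nonneg', unitInterval.le_one'⟩
  change ϑ (Icc 0 1) = 1
  rw [this, measure_univ]

lemma measure_Ioi_pos_of_lt_upperEnd {x : I} (hx : (x : ℝ) < upperEnd ϑ) : 0 < ϑ (Ioi x) := by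
  refine pos_iff_ne_zero.2 fun h => not_le.2 hx ?_
  refine csInf_le ⟨0, by rintro _ ⟨y, _, rfl⟩; exact y.2.1⟩ ⟨x, ?_, rfl⟩
  rw [← Icc_zero_compl, prob_compl_eq_zero_iff measurableSet_Icc] at h
  exact h

lemma ae_le_upperEnd : ∀ᵐ s : I ∂ϑ, (s : ℝ) ≤ upperEnd ϑ := by
  rw [ae_iff]
  refine measure_null_of_locally_null _ fun s hs => ?_
  have hs' : upperEnd ϑ < s := not_le.1 hs
  obtain ⟨_, ⟨x, hx, rfl⟩, hsx⟩ := exists_lt_of_csInf_lt ⟨1, one_mem_upperEnd⟩ hs'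
  refine ⟨Ioi x, mem_nhdsWithin_of_mem_nhds (Ioi_mem_nhds hsx), ?_⟩
  rw [← Icc_zero_compl, prob_compl_eq_zero_iff measurableSet_Icc]
  exact hx

end Ends

/-! ### The radial part of the copula measure and its null sets. -/

section RadialPart

variable {γ : Measure ℝ≥0} {ϑ : Measure I}

/-- The event that the second coordinate is given by the radius, and not by the angle. -/
def radialEvent (ϑ : Measure I) : Set (ℝ × ℝ≥0 × I) :=
  {ω | secondCoord ϑ ω * ω.2.2 < ω.1 * (1 - (ω.2.2 : ℝ))}

/-- The part of the measure of an Archimax copula that comes from the radial event. -/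
noncomputable def radialPart (γ : Measure ℝ≥0) [IsProbabilityMeasure γ] (ϑ : Measure I) :
    Measure (I × I) :=
  ((sampleMeasure γ ϑ).restrict (radialEvent ϑ)).map (samplePair γ ϑ)

lemma ae_sampleMeasure_of_ae_angle [SFinite γ] [SFinite ϑ] {p : I → Prop} (h : ∀ᵐ s ∂ϑ, p s) :
    ∀ᵐ ω ∂sampleMeasure γ ϑ, p ω.2.2 := by
  refine ae_baseMeasure_of_sampleMeasure ?_
  exact (Measure.quasiMeasurePreserving_snd.comp Measure.quasiMeasurePreserving_snd).ae h

lemma ae_sampleMeasure_of_ae_radius [IsProbabilityMeasure ϑ] {p : ℝ≥0 → Prop}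
    (h : ∀ᵐ t ∂γ, p t) :
    ∀ᵐ ω ∂sampleMeasure γ ϑ, p ω.2.1 := by
  refine ae_baseMeasure_of_sampleMeasure ?_
  exact (Measure.quasiMeasurePreserving_fst.comp Measure.quasiMeasurePreserving_snd).ae h

variable [IsProbabilityMeasure γ] [IsProbabilityMeasure ϑ]

omit [IsProbabilityMeasure γ] in
lemma measurableSet_radialEvent (hϑ : ∫ x : I, (x : ℝ) ∂ϑ = 1 / 2) :
    MeasurableSet (radialEvent ϑ) :=
  measurableSet_lt ((measurable_secondCoord hϑ).mul (by fun_prop)) (by fun_prop)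

lemma radialPart_apply (hϑ : ∫ x : I, (x : ℝ) ∂ϑ = 1 / 2) {N : Set (I × I)}
    (hN : MeasurableSet N) :
    radialPart γ ϑ N = sampleMeasure γ ϑ (samplePair γ ϑ ⁻¹' N ∩ radialEvent ϑ) := by
  rw [radialPart, Measure.map_apply (measurable_samplePair hϑ) hN,
    Measure.restrict_apply (measurable_samplePair hϑ hN)]

lemma radialPart_le (h0 : γ {0} = 0) (hϑ : ∫ x : I, (x : ℝ) ∂ϑ = 1 / 2) :
    radialPart γ ϑ ≤ (archimaxCopula γ ϑ h0 hϑ).measure :=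
  Measure.map_mono Measure.restrict_le_self (measurable_samplePair hϑ)

/-- Uniform marginals do not charge `0`. -/
lemma ae_psi_pos (h0 : γ {0} = 0) (hϑ : ∫ x : I, (x : ℝ) ∂ϑ = 1 / 2) :
    ∀ᵐ ω ∂sampleMeasure γ ϑ, 0 < psi γ ω.1 ∧ 0 < psi γ (secondCoord ϑ ω) := by
  have key : ∀ᵐ p ∂(archimaxCopula γ ϑ h0 hϑ).measure, p.1 ≠ 0 ∧ p.2 ≠ 0 := by
    refine Filter.Eventually.and ?_ ?_
    · rw [ae_iff]
      convert (archimaxCopula γ ϑ h0 hϑ).measure_fst_preimage (measurableSet_singleton 0) using 2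
      · ext p; simp
      · simp
    · rw [ae_iff]
      convert (archimaxCopula γ ϑ h0 hϑ).measure_snd_preimage (measurableSet_singleton 0) using 2
      · ext p; simp
      · simp
  filter_upwards [ae_of_ae_map (measurable_samplePair hϑ).aemeasurable key] with ω hω
  exact ⟨unitInterval.pos_iff_ne_zero.2 hω.1, unitInterval.pos_iff_ne_zero.2 hω.2⟩

omit [IsProbabilityMeasure γ] in
lemma mem_regularSet_of_radialEvent (hϑ : ∫ x : I, (x : ℝ) ∂ϑ = 1 / 2) {ω : ℝ × ℝ≥0 × I}
    (h1 : 0 < ω.1) (h2 : ω.1 * (ω.2.1 : ℝ) < 1) (h3 : 0 < ω.2.1) (h4 : 0 < secondCoord ϑ ω)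
    (h5 : 0 < psi γ (secondCoord ϑ ω)) (h6 : ω ∈ radialEvent ϑ) :
    secondCoord ϑ ω ∈ regularSet γ ϑ ω.1 ∧
      (ω.2.1 : ℝ) * tailDep ϑ ω.1 (secondCoord ϑ ω) = 1 := by
  have h7 := le_antisymm (secondCoord_spec hϑ h4).1 (mul_tailDep_secondCoord hϑ h1 h3 h6)
  refine ⟨⟨h4, h5, ?_⟩, h7⟩
  have h3' : 0 < (ω.2.1 : ℝ) := h3
  rw [← h7, mul_comm] at h2
  -- Comparing `ta < 1` with `tℓ(a,b) = 1` gives `a < ℓ(a,b)`.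
  exact lt_of_mul_lt_mul_left h2 h3'.le

/-- A criterion for sets to be negligible for the radial part. -/
lemma radialPart_eq_zero (h0 : γ {0} = 0) (hϑ : ∫ x : I, (x : ℝ) ∂ϑ = 1 / 2)
    {N : Set (I × I)} (hN : MeasurableSet N)
    (h : ∀ a, 0 ≤ a → γ {t | ∃ y ∈ Prod.mk (psiI γ a) ⁻¹' N, radialRel γ ϑ a t y} = 0) :
    radialPart γ ϑ N = 0 := by
  have hZ := measurable_secondCoord hϑ
  set S : Set (ℝ × ℝ≥0 × I) := {ω | 0 < ω.1} ∩ ({ω | ω.1 * (ω.2.1 : ℝ) < 1} ∩ ({ω | 0 < ω.2.1} ∩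
    ({ω | 0 < secondCoord ϑ ω} ∩ ({ω | 0 < psi γ (secondCoord ϑ ω)} ∩
      (samplePair γ ϑ ⁻¹' N ∩ radialEvent ϑ))))) with hS
  have hSm : MeasurableSet S := by
    refine (measurableSet_lt (by fun_prop) (by fun_prop)).inter
      (MeasurableSet.inter (measurableSet_lt (by fun_prop) (by fun_prop))
      (MeasurableSet.inter (measurableSet_lt (by fun_prop) (by fun_prop))
      ((measurableSet_lt measurable_const hZ).inter
      ((measurableSet_lt measurable_const (continuous_psi.measurable.comp hZ)).inter
      ((measurable_samplePair hϑ hN).inter (measurableSet_radialEvent hϑ))))))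
  have hS0 : baseMeasure γ ϑ S = 0 := by
    rw [baseMeasure, Measure.measure_prod_null hSm]
    refine Eventually.of_forall fun a => ?_
    rcases lt_or_ge 0 a with ha | ha
    -- For fixed `a` only the radius matters: it must be related to some `y` in the section of `N`,
    -- whatever the angle.
    · have hsub : Prod.mk a ⁻¹' S ⊆
          {t | ∃ y ∈ Prod.mk (psiI γ a) ⁻¹' N, radialRel γ ϑ a t y} ×ˢ univ := by
        rintro ⟨t, s⟩ ⟨h1, h2, h3, h4, h5, h6, h7⟩
        have h8 := mem_regularSet_of_radialEvent hϑ h1 h2 h3 h4 h5 h7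
        exact ⟨⟨psiI γ (secondCoord ϑ (a, t, s)), h6, _, h8.1, rfl, h8.2⟩, mem_univ _⟩
      refine measure_mono_null hsub ?_
      rw [Measure.prod_prod, h a ha.le, zero_mul]
    · have : Prod.mk a ⁻¹' S = ∅ :=
        eq_empty_of_forall_notMem fun p hp => absurd hp.1 (not_lt.2 ha)
      simp [this]
  rw [radialPart_apply hϑ hN, measure_eq_zero_iff_ae_notMem]
  filter_upwards [ae_sampleMeasure (γ := γ) (ϑ := ϑ), ae_secondCoord_pos (γ := γ) hϑ,
    ae_psi_pos h0 hϑ, ae_baseMeasure_of_sampleMeasure (measure_eq_zero_iff_ae_notMem.1 hS0)]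
    with ω h1 h2 h3 h4 h5
  exact h4 ⟨h1.1, h1.2.1, h1.2.2.1, h2, h3.2, h5⟩

/-- The set of points of the unit square that correspond to radial variables in `G`. -/
def radialCarrier (γ : Measure ℝ≥0) [IsProbabilityMeasure γ] (ϑ : Measure I) (G : Set ℝ≥0) :
    Set (I × I) :=
  (fun p : ℝ × ℝ => (psiI γ p.1, psiI γ p.2)) '' {p | (0 < p.1 ∧ 0 < psi γ p.1) ∧
    (p.2 ∈ regularSet γ ϑ p.1 ∧ (1 / tailDep ϑ p.1 p.2).toNNReal ∈ G)}

/-- Positivity of `ψ` at both coordinates makes the parametrization injective, so the image of a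
Borel set is Borel (Lusin–Souslin). -/
lemma measurableSet_radialCarrier (h0 : γ {0} = 0) {G : Set ℝ≥0} (hG : MeasurableSet G) :
    MeasurableSet (radialCarrier γ ϑ G) := by
  have hl : Measurable fun p : ℝ × ℝ => tailDep ϑ p.1 p.2 := continuous_tailDep.measurable
  have hp : Measurable (psi γ) := continuous_psi.measurable
  have m1 : MeasurableSet {p : ℝ × ℝ | 0 < p.1} := measurableSet_lt (by fun_prop) (by fun_prop)
  have m2 : MeasurableSet {p : ℝ × ℝ | 0 < psi γ p.1} := measurableSet_lt (by fun_prop) (by fun_prop)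
  have m3 : MeasurableSet {p : ℝ × ℝ | 0 < p.2} := measurableSet_lt (by fun_prop) (by fun_prop)
  have m4 : MeasurableSet {p : ℝ × ℝ | 0 < psi γ p.2} := measurableSet_lt (by fun_prop) (by fun_prop)
  have m5 : MeasurableSet {p : ℝ × ℝ | p.1 < tailDep ϑ p.1 p.2} :=
    measurableSet_lt (by fun_prop) (by fun_prop)
  have m6 : MeasurableSet {p : ℝ × ℝ | (1 / tailDep ϑ p.1 p.2).toNNReal ∈ G} :=
    (measurable_real_toNNReal.comp (measurable_const.div hl)) hG
  refine MeasurableSet.image_of_measurable_injOn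
    ((m1.inter m2).inter ((m3.inter (m4.inter m5)).inter m6)) ?_ ?_
  · exact (continuous_psiI.measurable.comp measurable_fst).prodMk
      (continuous_psiI.measurable.comp measurable_snd)
  · rintro ⟨a, b⟩ ⟨⟨h1, h2⟩, ⟨h3, h4, _⟩, _⟩ ⟨a', b'⟩ ⟨⟨h1', h2'⟩, ⟨h3', h4', _⟩, _⟩ heq
    have e := Prod.ext_iff.1 heq
    exact Prod.ext (psi_injOn h0 h1.le h1'.le h2 (congrArg Subtype.val e.1))
      (psi_injOn h0 h3.le h3'.le h4 (congrArg Subtype.val e.2))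

omit [IsProbabilityMeasure ϑ] in
lemma radialCarrier_section (h0 : γ {0} = 0) (G : Set ℝ≥0)
    (x : I) : ∃ a, 0 ≤ a ∧
      Prod.mk x ⁻¹' radialCarrier γ ϑ G ⊆ {y | ∃ t ∈ G, radialRel γ ϑ a t y} := by
  rcases (Prod.mk x ⁻¹' radialCarrier γ ϑ G).eq_empty_or_nonempty with h | ⟨_, ⟨a, b⟩, hab, hy⟩
  · exact ⟨0, le_rfl, by simp [h]⟩
  refine ⟨a, hab.1.1.le, ?_⟩
  rintro _ ⟨⟨a', b'⟩, ⟨h1, h2, h3⟩, hy'⟩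
  have e := Prod.ext_iff.1 hy
  have e' := Prod.ext_iff.1 hy'
  have haa : a' = a := psi_injOn h0 h1.1.le hab.1.1.le h1.2
    (congrArg Subtype.val (e'.1.trans e.1.symm))
  subst haa
  refine ⟨_, h3, b', h2, e'.2, ?_⟩
  have hpos : 0 < tailDep ϑ a' b' := h1.1.trans h2.2.2
  rw [Real.coe_toNNReal _ (by positivity)]
  exact one_div_mul_cancel hpos.ne'

lemma radialPart_compl_radialCarrier (h0 : γ {0} = 0) (hϑ : ∫ x : I, (x : ℝ) ∂ϑ = 1 / 2)
    {G : Set ℝ≥0} (hG : MeasurableSet G) (hγ : γ Gᶜ = 0) :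
    radialPart γ ϑ (radialCarrier γ ϑ G)ᶜ = 0 := by
  rw [radialPart_apply hϑ (measurableSet_radialCarrier h0 hG).compl,
    measure_eq_zero_iff_ae_notMem]
  have hG' : ∀ᵐ t ∂γ, t ∈ G := hγ
  filter_upwards [ae_sampleMeasure (γ := γ) (ϑ := ϑ), ae_secondCoord_pos (γ := γ) hϑ,
    ae_psi_pos h0 hϑ, ae_sampleMeasure_of_ae_radius (ϑ := ϑ) hG'] with ω h1 h2 h3 h4 h5
  have h8 := mem_regularSet_of_radialEvent hϑ h1.1 h1.2.1 h1.2.2.1 h2 h3.2 h5.2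
  refine h5.1 ⟨(ω.1, secondCoord ϑ ω), ⟨⟨h1.1, h3.1⟩, h8.1, ?_⟩, rfl⟩
  rw [← eq_one_div_of_mul_eq_one_left h8.2, Real.toNNReal_coe]
  exact h4

end RadialPart

/-! ### The radial part has full support. -/

section Support

variable {γ : Measure ℝ≥0} {ϑ : Measure I} [IsProbabilityMeasure γ] [IsProbabilityMeasure ϑ]

lemma continuous_psiI_prodMap :
    Continuous fun p : ℝ × ℝ => (psiI γ p.1, psiI γ p.2) :=
  (continuous_psiI.comp continuous_fst).prodMk (continuous_psiI.comp continuous_snd)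

omit [IsProbabilityMeasure γ] in
lemma sampleMeasure_box_pos {A : Set ℝ} {T : Set ℝ≥0} {S : Set I} (hA : 0 < volume A)
    (hT : 0 < γ T) (hS : 0 < ϑ S)
    (h : ∀ a ∈ A, ∀ t ∈ T, ∀ s ∈ S, 0 < a ∧ a * (t : ℝ) < 1 ∧ 0 < t ∧ (s : ℝ) < 1) [SFinite γ] :
    0 < sampleMeasure γ ϑ (A ×ˢ T ×ˢ S) := by
  refine pos_iff_ne_zero.2 fun h0 => ?_
  rw [sampleMeasure, withDensity_apply_eq_zero measurable_sampleDensity,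
    inter_eq_right.2, baseMeasure, Measure.prod_prod, Measure.prod_prod] at h0
  · exact (ENNReal.mul_pos hA.ne' (ENNReal.mul_pos hT.ne' hS.ne').ne').ne' h0
  · rintro ⟨a, t, s⟩ ⟨ha, ht, hs⟩
    exact sampleDensity_ne_zero.2 (h a ha t ht s hs)

omit [IsProbabilityMeasure γ] in
lemma lt_tailDep_of_lt_upperEnd (hϑ : ∫ x : I, (x : ℝ) ∂ϑ = 1 / 2) {a b : ℝ} (ha : 0 < a)
    (hb : 0 < b) (h : a < upperEnd ϑ * (a + b)) : a < tailDep ϑ a b := by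
  have hab : 0 < a + b := add_pos ha hb
  set q : I := ⟨a / (a + b), by positivity, by rw [div_le_one hab]; linarith⟩ with hq
  refine lt_tailDep_of_measure_pos hϑ ((measure_Ioi_pos_of_lt_upperEnd (x := q) ?_).trans_le
    (measure_mono fun s hs => ?_))
  · rwa [hq, div_lt_iff₀ hab]
  · have : a / (a + b) < s := hs
    rw [div_lt_iff₀ hab] at this
    change a * (1 - (s : ℝ)) < b * s
    linarith

/-- Interior points of the region have neighbourhoods of positive mass for the radial part. -/
lemma radialPart_pos_of_interior (hϑ : ∫ x : I, (x : ℝ) ∂ϑ = 1 / 2) {a b : ℝ} {t : ℝ≥0}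
    (ha : 0 < a) (hb : 0 < b) (hL : lowerEnd ϑ * (a + b) < a) (hR : a < upperEnd ϑ * (a + b))
    (ht : t ∈ γ.support) (htab : (t : ℝ) * tailDep ϑ a b = 1)
    {V : Set (I × I)} (hV : IsOpen V) (habV : (psiI γ a, psiI γ b) ∈ V) :
    0 < radialPart γ ϑ V := by
  have hab : 0 < a + b := add_pos ha hb
  have hal : a < tailDep ϑ a b := lt_tailDep_of_lt_upperEnd hϑ ha hb hR
  have ht0 : 0 < (t : ℝ) := by
    refine lt_of_le_of_ne t.coe_nonneg fun h => ?_
    rw [← h, zero_mul] at htab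
    exact zero_ne_one htab
  -- Angles `s ≤ q` have positive mass because `q > L`. Since `q < a/(a+b)`, for them the angular
  -- bound stays inactive near `(a,b)`.
  obtain ⟨q, hqL, hq⟩ := exists_between ((lt_div_iff₀ hab).2 hL)
  have hq' : q * (a + b) < a := (lt_div_iff₀ hab).1 hq
  have hq0 : 0 ≤ q := lowerEnd_nonneg.trans hqL.le
  have hq1 : q < 1 := hq.trans_le (by rw [div_le_one hab]; linarith)
  have hev : ∀ᶠ p : ℝ × ℝ in 𝓝 (a, b), ((psiI γ p.1, psiI γ p.2) ∈ V ∧ 0 < p.1 ∧ 0 < p.2) ∧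
      q * (p.1 + p.2) < p.1 ∧ p.1 < tailDep ϑ p.1 p.2 := by
    refine ((continuous_psiI_prodMap.continuousAt.eventually (hV.mem_nhds habV)).and
      (((continuous_fst.tendsto (a, b)).eventually_const_lt ha).and
      ((continuous_snd.tendsto (a, b)).eventually_const_lt hb))).and
      ((ContinuousAt.eventually_lt (f := fun p : ℝ × ℝ => q * (p.1 + p.2)) (by fun_prop)
        continuous_fst.continuousAt hq').and
      (continuous_fst.continuousAt.eventually_lt continuous_tailDep.continuousAt hal))
  obtain ⟨ε, hε, hball⟩ := Metric.eventually_nhds_iff_ball.1 hev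
  have hbox : ∀ x ∈ Metric.ball a ε, ∀ y ∈ Icc (b - ε / 2) (b + ε / 2),
      ((psiI γ x, psiI γ y) ∈ V ∧ 0 < x ∧ 0 < y) ∧ q * (x + y) < x ∧ x < tailDep ϑ x y := by
    intro x hx y hy
    refine hball (x, y) ?_
    rw [← ball_prod_same]
    refine ⟨hx, ?_⟩
    rw [Metric.mem_ball, Real.dist_eq, abs_lt]
    constructor <;> linarith [hy.1, hy.2]
  have hxa : a ∈ Metric.ball a ε := Metric.mem_ball_self hε
  have hm : b - ε / 2 ∈ Icc (b - ε / 2) (b + ε / 2) := ⟨le_rfl, by linarith⟩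
  have hp : b + ε / 2 ∈ Icc (b - ε / 2) (b + ε / 2) := ⟨by linarith, le_rfl⟩
  have hstrict : ∀ {y y' : ℝ}, a < tailDep ϑ a y → y < y' → tailDep ϑ a y < tailDep ϑ a y' := by
    intro y y' h hyy
    have h1 := tailDep_sub_ge (ϑ := ϑ) (a := a) hyy.le
    have h2 := mul_pos (sub_pos.2 hyy) (tailSlope_pos ha.le (measure_pos_of_lt_tailDep hϑ h))
    linarith
  have c1 : ∀ y : ℝ, Continuous fun p : ℝ × ℝ≥0 => (p.2 : ℝ) * tailDep ϑ p.1 y := fun y =>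
    (by fun_prop : Continuous fun p : ℝ × ℝ≥0 => (p.2 : ℝ)).mul
      (continuous_tailDep.comp (by fun_prop : Continuous fun p : ℝ × ℝ≥0 => (p.1, y)))
  -- Strict growth of `ℓ(a,·)` traps the radial solution in the window `b ± ε/2`, also for nearby
  -- first coordinates and radii.
  have h1 : (t : ℝ) * tailDep ϑ a (b - ε / 2) < 1 := by
    rw [← htab]
    exact mul_lt_mul_of_pos_left (hstrict (hbox a hxa _ hm).2.2 (by linarith)) ht0
  have h2 : 1 < (t : ℝ) * tailDep ϑ a (b + ε / 2) := by
    conv_lhs => rw [← htab]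
    exact mul_lt_mul_of_pos_left (hstrict hal (by linarith)) ht0
  have hev2 : ∀ᶠ p : ℝ × ℝ≥0 in 𝓝 (a, t), (p.2 : ℝ) * tailDep ϑ p.1 (b - ε / 2) < 1 ∧
      1 < (p.2 : ℝ) * tailDep ϑ p.1 (b + ε / 2) :=
    (((c1 _).tendsto (a, t)).eventually_lt_const h1).and (((c1 _).tendsto (a, t)).eventually_const_lt h2)
  obtain ⟨u, v, hu, hau, hv, htv, huv⟩ := mem_nhds_prod_iff'.1 hev2
  have hA : 0 < volume (u ∩ Metric.ball a ε) :=
    (hu.inter Metric.isOpen_ball).measure_pos volume ⟨a, hau, hxa⟩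
  have hT : 0 < γ v := (Measure.mem_support_iff_forall t).1 ht v (hv.mem_nhds htv)
  have hS : 0 < ϑ (Icc 0 ⟨q, hq0, hq1.le⟩) := measure_Icc_pos_of_lowerEnd_lt hqL
  have hpt : ∀ x ∈ u ∩ Metric.ball a ε, ∀ r ∈ v, ∀ s ∈ Icc 0 (⟨q, hq0, hq1.le⟩ : I),
      (r : ℝ) * tailDep ϑ x (b - ε / 2) < 1 ∧ 1 < (r : ℝ) * tailDep ϑ x (b + ε / 2) ∧ 0 < r ∧
      (b + ε / 2) * s < x * (1 - (s : ℝ)) ∧ (s : ℝ) < 1 := by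
    intro x hx r hr s hs
    have h3 : (r : ℝ) * tailDep ϑ x (b - ε / 2) < 1 ∧ 1 < (r : ℝ) * tailDep ϑ x (b + ε / 2) :=
      huv (mk_mem_prod hx.1 hr)
    have hsq : (s : ℝ) ≤ q := hs.2
    have h4 := hbox x hx.2 _ hp
    refine ⟨h3.1, h3.2, pos_iff_ne_zero.2 ?_, ?_, hsq.trans_lt hq1⟩
    · rintro rfl
      simp only [NNReal.coe_zero, zero_mul] at h3
      linarith [h3.2]
    · have h5 := mul_le_mul_of_nonneg_right hsq (add_pos h4.1.2.1 h4.1.2.2).le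
      linarith [h4.2.1]
  refine (sampleMeasure_box_pos hA hT hS fun x hx r hr s hs => ?_).trans_le ?_
  · obtain ⟨p1, p2, p3, p4, p5⟩ := hpt x hx r hr s hs
    have h4 := hbox x hx.2 _ hm
    refine ⟨h4.1.2.1, ?_, p3, p5⟩
    have := mul_le_mul_of_nonneg_left h4.2.2.le r.coe_nonneg
    linarith
  · rw [radialPart_apply hϑ hV.measurableSet]
    refine measure_mono ?_
    rintro ⟨x, r, s⟩ ⟨hx, hr, hs⟩
    obtain ⟨p1, p2, p3, p4, p5⟩ := hpt x hx r hr s hs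
    have h4 := hbox x hx.2 _ hm
    have h5 := hbox x hx.2 _ hp
    have s0 : 0 ≤ (s : ℝ) := s.2.1
    have hlow : b - ε / 2 < secondCoord ϑ (x, r, s) := by
      refine (lt_secondCoord hϑ h4.1.2.2.le).2 ⟨h4.1.2.1, p3, p1, lt_of_le_of_lt ?_ p4⟩
      exact mul_le_mul_of_nonneg_right (by linarith) s0
    have hupp : secondCoord ϑ (x, r, s) ≤ b + ε / 2 := by
      refine not_lt.1 fun h => ?_
      exact absurd ((lt_secondCoord hϑ h5.1.2.2.le).1 h).2.2.1 (not_lt.2 p2.le)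
    refine ⟨(hbox x hx.2 _ ⟨hlow.le, hupp⟩).1.1, ?_⟩
    exact (mul_le_mul_of_nonneg_right hupp s0).trans_lt p4

/-- Scaling by `c < 1` makes `tℓ < 1` strict. Sliding along the line of constant `a + b` then makes
the angle interior to `(L, R)`, which is possible because `L < R`. -/
lemma mem_support_radialPart (hϑ : ∫ x : I, (x : ℝ) ∂ϑ = 1 / 2)
    (hup : ∀ t ∈ γ.support, ∀ t', t ≤ t' → t' ∈ γ.support) (hLR : lowerEnd ϑ < upperEnd ϑ)
    {a b : ℝ} {t : ℝ≥0} (ha : 0 < a) (hb : 0 < b) (hL : lowerEnd ϑ * (a + b) ≤ a)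
    (hR : a ≤ upperEnd ϑ * (a + b)) (ht : t ∈ γ.support) (htab : (t : ℝ) * tailDep ϑ a b ≤ 1) :
    (psiI γ a, psiI γ b) ∈ (radialPart γ ϑ).support := by
  rw [Measure.mem_support_iff_forall]
  intro U hU
  obtain ⟨V, hVU, hV, habV⟩ := mem_nhds_iff.1 hU
  refine lt_of_lt_of_le ?_ (measure_mono hVU)
  have hc : ∀ᶠ c : ℝ in 𝓝[<] 1, (psiI γ (c * a), psiI γ (c * b)) ∈ V := by
    have h1 : Continuous fun c : ℝ => (psiI γ (c * a), psiI γ (c * b)) :=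
      continuous_psiI_prodMap.comp (by fun_prop : Continuous fun c : ℝ => (c * a, c * b))
    refine (h1.continuousAt.eventually (hV.mem_nhds ?_)).filter_mono nhdsWithin_le_nhds
    simpa using habV
  have hc0 : ∀ᶠ c : ℝ in 𝓝[<] 1, 0 < c :=
    (eventually_gt_nhds one_pos).filter_mono nhdsWithin_le_nhds
  obtain ⟨c, ⟨hcV, hc0⟩, hc1⟩ := ((hc.and hc0).and self_mem_nhdsWithin).exists
  have hc1 : c < 1 := hc1
  have hab : 0 < a + b := add_pos ha hb
  have hcl : (t : ℝ) * tailDep ϑ (c * a) (c * b) < 1 := by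
    rw [tailDep_smul hc0.le, mul_left_comm]
    nlinarith
  set r := c * (a + b) with hr
  have hr0 : 0 < r := mul_pos hc0 hab
  have hs : a / (a + b) ∈ closure (Ioo (lowerEnd ϑ) (upperEnd ϑ)) := by
    rw [closure_Ioo hLR.ne]
    exact ⟨(le_div_iff₀ hab).2 hL, (div_le_iff₀ hab).2 hR⟩
  have e1 : r * (a / (a + b)) = c * a := by rw [hr]; field_simp
  have e2 : r * (1 - a / (a + b)) = c * b := by rw [hr]; field_simp; ring
  have hline : Continuous fun s : ℝ => (r * s, r * (1 - s)) := by fun_prop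
  have hev : ∀ᶠ s : ℝ in 𝓝 (a / (a + b)), ((psiI γ (r * s), psiI γ (r * (1 - s))) ∈ V ∧
      (t : ℝ) * tailDep ϑ (r * s) (r * (1 - s)) < 1) ∧ 0 < r * s ∧ 0 < r * (1 - s) := by
    refine Eventually.and (Eventually.and ?_ ?_) (Eventually.and ?_ ?_)
    · refine (continuous_psiI_prodMap.comp hline).continuousAt.eventually (hV.mem_nhds ?_)
      simpa only [Function.comp, e1, e2] using hcV
    · have c1 : Continuous fun s : ℝ => (t : ℝ) * tailDep ϑ (r * s) (r * (1 - s)) :=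
        continuous_const.mul (continuous_tailDep.comp hline)
      exact (c1.tendsto _).eventually_lt_const (by simpa only [e1, e2] using hcl)
    · have c1 : Continuous fun s : ℝ => r * s := by fun_prop
      exact (c1.tendsto _).eventually_const_lt (by simpa only [e1] using mul_pos hc0 ha)
    · have c1 : Continuous fun s : ℝ => r * (1 - s) := by fun_prop
      exact (c1.tendsto _).eventually_const_lt (by simpa only [e2] using mul_pos hc0 hb)
  obtain ⟨s, ⟨hsL, hsR⟩, ⟨hsV, hst⟩, hs1, hs2⟩ :=
    ((mem_closure_iff_frequently.1 hs).and_eventually hev).exists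
  have hsum : r * s + r * (1 - s) = r := by ring
  have hpos : 0 < tailDep ϑ (r * s) (r * (1 - s)) :=
    hs1.trans_le (le_tailDep_left hϑ hs1.le hs2.le)
  -- The radius solving the radial equation at the new point is at least `t`, so it stays in the
  -- upward closed support.
  refine radialPart_pos_of_interior hϑ (t := (1 / tailDep ϑ (r * s) (r * (1 - s))).toNNReal)
    hs1 hs2 ?_ ?_ (hup t ht _ ?_) ?_ hV hsV
  · rw [hsum, mul_comm r s]; exact mul_lt_mul_of_pos_right hsL hr0
  · rw [hsum, mul_comm r s]; exact mul_lt_mul_of_pos_right hsR hr0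
  · refine NNReal.le_toNNReal_of_coe_le ?_
    rw [le_div_iff₀ hpos]
    exact hst.le
  · rw [Real.coe_toNNReal _ (by positivity)]
    exact one_div_mul_cancel hpos.ne'

theorem support_subset_support_radialPart (h0 : γ {0} = 0) (hϑ : ∫ x : I, (x : ℝ) ∂ϑ = 1 / 2)
    (hup : ∀ t ∈ γ.support, ∀ t', t ≤ t' → t' ∈ γ.support) (hLR : lowerEnd ϑ < upperEnd ϑ) :
    (archimaxCopula γ ϑ h0 hϑ).measure.support ⊆ (radialPart γ ϑ).support := by
  refine Measure.support_subset_of_isClosed Measure.isClosed_support ?_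
  change ∀ᵐ p ∂(sampleMeasure γ ϑ).map (samplePair γ ϑ), p ∈ (radialPart γ ϑ).support
  refine (ae_map_iff (p := (· ∈ (radialPart γ ϑ).support))
    (measurable_samplePair hϑ).aemeasurable Measure.isClosed_support.measurableSet).2 ?_
  have hsupp : ∀ᵐ t ∂γ, t ∈ γ.support := Measure.support_mem_ae
  filter_upwards [ae_sampleMeasure (γ := γ) (ϑ := ϑ), ae_secondCoord_pos (γ := γ) hϑ,
    ae_psi_pos h0 hϑ, ae_sampleMeasure_of_ae_radius (ϑ := ϑ) hsupp,
    ae_sampleMeasure_of_ae_angle (γ := γ) (ϑ := ϑ) ae_lowerEnd_le,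
    ae_sampleMeasure_of_ae_angle (γ := γ) (ϑ := ϑ) ae_le_upperEnd] with ω h1 h2 h3 h4 h5 h6
  have h7 := secondCoord_spec hϑ h2
  have hab : 0 < ω.1 + secondCoord ϑ ω := add_pos h1.1 h2
  refine mem_support_radialPart hϑ hup hLR h1.1 h2 ?_ ?_ h4 h7.1
  · have := mul_le_mul_of_nonneg_right h5 hab.le
    linarith [h7.2]
  -- On the radial event `a < ℓ(a,b)` yields some angle `s ≤ R` with `a < s(a+b)`; off it, the
  -- sampled angle satisfies `a ≤ s(a+b)`.
  · by_cases h8 : ω ∈ radialEvent ϑ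
    · have h9 := (mem_regularSet_of_radialEvent (γ := γ) hϑ h1.1 h1.2.1 h1.2.2.1 h2 h3.2 h8).1.2.2
      obtain ⟨s, hs, hsR⟩ := (frequently_ae_mem_iff.2
        (measure_pos_of_lt_tailDep hϑ h9).ne').and_eventually (ae_le_upperEnd (ϑ := ϑ)) |>.exists
      have hs' : ω.1 * (1 - (s : ℝ)) < secondCoord ϑ ω * s := hs
      have := mul_le_mul_of_nonneg_right hsR hab.le
      linarith
    · have h9 : ω.1 * (1 - (ω.2.2 : ℝ)) ≤ secondCoord ϑ ω * ω.2.2 := not_lt.1 h8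
      have := mul_le_mul_of_nonneg_right h6 hab.le
      linarith

end Support

end Archimax

/-! ### The main theorem. -/

theorem mainTheorem5
    (γ : MeasureTheory.Measure ℝ≥0) (hγ : Archimax.IsWilliamson γ)
    (ϑ : MeasureTheory.Measure I) (hϑ : Archimax.IsPickands ϑ)
    (hsupp : γ.support =
      {t : ℝ≥0 | 1 / Archimax.pseudoInverse (Archimax.generator γ) 0 ≤ (t : ℝ≥0∞)})
    (hLR : Archimax.lowerEnd ϑ < Archimax.upperEnd ϑ) :
    (∃! C : Archimax.Copula, Archimax.IsArchimaxCopula γ ϑ C) ∧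
    ∀ C : Archimax.Copula, Archimax.IsArchimaxCopula γ ϑ C →
      (Archimax.IsAbsolutelyContinuous γ → C.absComponent.support = C.measure.support) ∧
      (Archimax.IsDiscrete γ → C.disComponent.support = C.measure.support) ∧
      (Archimax.IsSingular γ → C.singComponent.support = C.measure.support) := by
  open Archimax in
  obtain ⟨hγ1, h0⟩ := hγ
  obtain ⟨hϑ1, hm⟩ := hϑ
  have hC := isArchimaxCopula_archimaxCopula (γ := γ) h0 hm
  refine ⟨⟨_, hC, fun D hD => hD.unique hC⟩, fun D hD => ?_⟩
  obtain rfl := hD.unique hC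
  -- The exact left end point of the support plays no role: only upward closedness is needed.
  have hup : ∀ t ∈ γ.support, ∀ t', t ≤ t' → t' ∈ γ.support := by
    rw [hsupp]
    exact fun t ht t' htt => le_trans (show _ ≤ _ from ht) (ENNReal.coe_le_coe.2 htt)
  have hle := radialPart_le h0 hm
  have hsub := support_subset_support_radialPart h0 hm hup hLR
  refine ⟨fun hac => ?_, ?_, ?_⟩
  · refine (Measure.support_mono (Copula.absComponent_le _)).antisymm (hsub.trans ?_)
    refine Copula.support_subset_absComponent hle fun N hN hnull => ?_
    exact radialPart_eq_zero h0 hm hN fun a ha => hac (lebesgue_radialRel h0 hm ha (hnull _))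
  · rintro ⟨S, hS, hSγ⟩
    refine (Measure.support_mono (Copula.disComponent_le _)).antisymm (hsub.trans ?_)
    refine Copula.support_subset_disComponent hle
      (measurableSet_radialCarrier h0 hS.measurableSet)
      (radialPart_compl_radialCarrier h0 hm hS.measurableSet hSγ) fun x => ?_
    obtain ⟨a, ha, hsec⟩ := radialCarrier_section (ϑ := ϑ) h0 S x
    exact (countable_radialRel_right hm ha hS).mono hsec
  · rintro ⟨hatom, G, hG, hG0, hGγ⟩
    refine (Measure.support_mono (Copula.singComponent_le _)).antisymm (hsub.trans ?_)
    have hGc : γ Gᶜ = 0 := by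
      rw [measure_univ] at hGγ
      exact (prob_compl_eq_zero_iff hG).2 hGγ
    refine Copula.support_subset_singComponent hle (measurableSet_radialCarrier h0 hG)
      (radialPart_compl_radialCarrier h0 hm hG hGc) (fun x => ?_) fun N hN hcount => ?_
    · obtain ⟨a, ha, hsec⟩ := radialCarrier_section (ϑ := ϑ) h0 G x
      exact measure_mono_null hsec (volume_radialRel h0 hm ha hG0)
    · have : NullSingletonClass γ := ⟨hatom⟩
      exact radialPart_eq_zero h0 hm hN fun a ha =>
        (countable_radialRel_left h0 (hcount _)).measure_zero γ
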